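/- Graphs here are undirected with a self loop at each vertex (a set with a reflexive symmetric adjacency relation), and a graph homomorphism is a map of vertices preserving adjacency. For a graph $\Gamma$ let $A\Gamma=\langle v\in\Gamma \mid vw=wv \text{ whenever } v,w \text{ are adjacent}\rangle$ be its right-angled Artin group, and for a group $G$ let $CG$ be the commutation graph, whose vertices are the elements of $G$, with $g,h$ adjacent iff $gh=hg$. The functors $A\dashv C$ form an adjunction between graphs and groups, with unit $\eta_\Gamma:\Gamma\to CA\Gamma$, $v\mapsto v$. Thus $AC$ is a comonad on groups: $ACG$ is generated by symbols $[g]$, $g\in G$, with $[g][h]=[h][g]$ whenever $gh=hg$; the counit is $\epsilon_G:[g]\mapsto g$ and the comultiplication is $\delta_G:[g]\mapsto[[g]]$. An $AC$-coalgebra is a group $G$ with a homomorphism $\mathfrak g:G\to ACG$ such that $\epsilon_G\circ\mathfrak g=1_G$ and $AC(\mathfrak g)\circ\mathfrak g=\delta_G\circ\mathfrak g$; an isomorphism of coalgebras is a group isomorphism compatible with the structure maps. A graph presenting $(G,\mathfrak g)$ is a graph $\Gamma$ together with an isomorphism of coalgebras $\alpha:(A\Gamma,A\eta_\Gamma)\cong(G,\mathfrak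 g)$. **Theorem.** There is an algorithm (a partial recursive function) which takes as input a finite description of a homomorphism $f:G\to H$ between finitely presented groups carrying $AC$-coalgebra structures $\mathfrak g:G\to ACG$ and $\mathfrak h:H\to ACH$, namely: finite presentations of $G$ and $H$; for each generator $x$ of $G$, a word in the symbols $[w]^{\pm1}$, with each $w$ a word in the generators of $G$, representing $\mathfrak g(x)$; likewise for $\mathfrak h$; and, for each generator $x$ of $G$, a word in the generators of $H$ representing $f(x)$. On every such input the algorithm halts and decides whether $f$ is $A\varphi$ for a graph homomorphism $\varphi$ of the graphs presenting $G$ and $H$. That is: graphs presenting $(G,\mathfrak g)$ and $(H,\mathfrak h)$ exist, and for all such graphs $(\Gamma,\alpha)$ and $(\Delta,\beta)$ the answer is "yes" if and only if there is a graph homomorphism $\varphi:\Gamma\to\Delta$ with $f\circ\alpha=\beta\circ A\varphi$. -/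

import Mathlib

open CategoryTheory
open scoped commutatorElement

universe u

/-! ### Reflexive graphs, right-angled Artin groups, commutation graphs -/

/-- A graph: a symmetric adjacency relation with a self loop at each vertex. -/
structure Gph : Type (u + 1) where
  V : Type u
  Adj : V → V → Prop
  symm : ∀ v w, Adj v w → Adj w v
  refl : ∀ v, Adj v v

namespace Gph

/-- A graph homomorphism: a map on vertices that preserves adjacency. Because of the self loops,
an edge may be collapsed to a vertex. -/
@[ext]
structure Hom (Γ Δ : Gph.{u}) : Type u where
  toFun : Γ.V → Δ.V
  map_adj : ∀ v w, Γ.Adj v w → Δ.Adj (toFun v) (toFun w)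

instance : Category Gph.{u} where
  Hom := Hom
  id Γ := ⟨id, fun _ _ h => h⟩
  comp φ ψ := ⟨ψ.toFun ∘ φ.toFun, fun _ _ h => ψ.map_adj _ _ (φ.map_adj _ _ h)⟩

end Gph

/-- The defining relators of the right-angled Artin group of `Γ`: the commutators of adjacent
vertices. -/
def raagRels (Γ : Gph.{u}) : Set (FreeGroup Γ.V) :=
  {r | ∃ v w, Γ.Adj v w ∧ r = ⁅FreeGroup.of v, FreeGroup.of w⁆}

/-- The right-angled Artin group `A Γ`. -/
abbrev Raag (Γ : Gph.{u}) : Type u := PresentedGroup (raagRels Γ)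

namespace Raag

/-- The generator of `A Γ` that belongs to the vertex `v`. -/
def of {Γ : Gph.{u}} (v : Γ.V) : Raag Γ := PresentedGroup.of v

theorem of_comm {Γ : Gph.{u}} {v w : Γ.V} (h : Γ.Adj v w) :
    (of v * of w : Raag Γ) = of w * of v := by
  have h1 : PresentedGroup.mk (raagRels Γ) ⁅FreeGroup.of v, FreeGroup.of w⁆ = 1 :=
    PresentedGroup.one_of_mem ⟨v, w, h, rfl⟩
  rw [map_commutatorElement, commutatorElement_eq_one_iff_mul_comm] at h1
  exact h1

/-- The universal property of `A Γ`. -/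
def lift {Γ : Gph.{u}} {G : Type u} [Group G] (x : Γ.V → G)
    (hx : ∀ v w, Γ.Adj v w → x v * x w = x w * x v) : Raag Γ →* G :=
  PresentedGroup.toGroup (f := x) (by
    rintro r ⟨v, w, hvw, rfl⟩
    rw [map_commutatorElement, FreeGroup.lift_apply_of, FreeGroup.lift_apply_of,
      commutatorElement_eq_one_iff_mul_comm]
    exact hx v w hvw)

theorem lift_of {Γ : Gph.{u}} {G : Type u} [Group G] (x : Γ.V → G)
    (hx : ∀ v w, Γ.Adj v w → x v * x w = x w * x v) (v : Γ.V) : lift x hx (of v) = x v :=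
  PresentedGroup.toGroup.of _

theorem hom_ext {Γ : Gph.{u}} {G : Type u} [Group G] {f g : Raag Γ →* G}
    (h : ∀ v, f (of v) = g (of v)) : f = g :=
  PresentedGroup.ext h

/-- The homomorphism `A φ`, which sends the generator `v` to the generator `φ v`. -/
def map {Γ Δ : Gph.{u}} (φ : Γ ⟶ Δ) : Raag Γ →* Raag Δ :=
  lift (fun v => of (φ.toFun v)) fun v w h => of_comm (φ.map_adj v w h)

theorem map_of {Γ Δ : Gph.{u}} (φ : Γ ⟶ Δ) (v : Γ.V) : map φ (of v) = of (φ.toFun v) :=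
  lift_of _ _ v

end Raag

/-- The functor `A : Gph ⥤ Grp`. -/
def raagFunctor : Gph.{u} ⥤ GrpCat.{u} where
  obj Γ := GrpCat.of (Raag Γ)
  map φ := GrpCat.ofHom (Raag.map φ)
  map_id _ := GrpCat.hom_ext (Raag.hom_ext fun v => Raag.map_of _ v)
  map_comp φ ψ := GrpCat.hom_ext (Raag.hom_ext fun v =>
    (Raag.map_of _ v).trans
      ((congrArg (Raag.map ψ) (Raag.map_of φ v)).trans (Raag.map_of ψ _)).symm)

/-- The commutation graph `C G`: its vertices are the elements of `G`, and two of them are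
adjacent when they commute. -/
abbrev commutationGraph (G : Type u) [Group G] : Gph.{u} where
  V := G
  Adj g h := g * h = h * g
  symm _ _ h := h.symm
  refl _ := rfl

/-- The functor `C : Grp ⥤ Gph`. -/
def commutationFunctor : GrpCat.{u} ⥤ Gph.{u} where
  obj G := commutationGraph G
  map f :=
    { toFun := fun g => f.hom g
      map_adj := fun g h (hgh : g * h = h * g) =>
        (map_mul f.hom g h).symm.trans ((congrArg f.hom hgh).trans (map_mul f.hom h g)) }

/-- The graph homomorphism `η : Γ → C (A Γ)`, `v ↦ v`. -/
def raagUnit (Γ : Gph.{u}) : Γ ⟶ commutationGraph (Raag Γ) where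
  toFun v := Raag.of v
  map_adj _ _ h := Raag.of_comm h

/-- The homomorphism `ε : AC G → G`, `[g] ↦ g`. -/
def raagCounit (G : Type u) [Group G] : Raag (commutationGraph G) →* G :=
  Raag.lift (Γ := commutationGraph G) (fun g => g) fun _ _ h => h

theorem raagCounit_of {G : Type u} [Group G] (g : G) :
    raagCounit G (Raag.of (Γ := commutationGraph G) g) = g :=
  Raag.lift_of (Γ := commutationGraph G) _ _ g

/-- The adjunction `A ⊣ C`, with unit `η` and counit `ε`. -/
def raagAdjunction : raagFunctor.{u} ⊣ commutationFunctor.{u} :=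
  Adjunction.mkOfUnitCounit
    { unit :=
        { app := raagUnit
          naturality := fun _ _ φ => Gph.Hom.ext (funext fun v => (Raag.map_of φ v).symm) }
      counit :=
        { app := fun G => GrpCat.ofHom (raagCounit G)
          naturality := fun G H f => GrpCat.hom_ext (Raag.hom_ext fun g =>
            ((congrArg (raagCounit H) (Raag.map_of (commutationFunctor.map f) g)).trans
              (raagCounit_of (f.hom g))).trans (congrArg f.hom (raagCounit_of (G := G) g)).symm) }
      left_triangle := NatTrans.ext (funext fun Γ => GrpCat.hom_ext (Raag.hom_ext fun v =>
        (congrArg (raagCounit (Raag Γ)) (Raag.map_of (raagUnit Γ) v)).trans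
          (raagCounit_of (Raag.of v))))
      right_triangle := NatTrans.ext (funext fun G => Gph.Hom.ext (funext fun g =>
        raagCounit_of (G := G) g)) }

/-- The comonad `AC` on groups. -/
abbrev acComonad : Comonad GrpCat.{u} := raagAdjunction.toComonad

/-- Groups with an `AC`-coalgebra structure: `G.A` is the group, `G.a : G.A ⟶ AC G.A` is the
structure map. Morphisms are the `AC`-cohomomorphisms. -/
abbrev ACCoalgebra : Type (u + 1) := acComonad.{u}.Coalgebra

/-- A graph presenting the coalgebra `G`: a graph `Γ` with an isomorphism of coalgebras between
`A Γ`, with its canonical structure map `A η : A Γ ⟶ AC (A Γ)`, and `G`. -/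
structure GraphPresentation (G : ACCoalgebra.{u}) where
  graph : Gph.{u}
  iso : (Comonad.comparison raagAdjunction).obj graph ≅ G

/-- Under the identifications of `G` with `A Γ` and of `H` with `A Δ`, the group homomorphism `f`
is `A φ` for some graph homomorphism `φ : Γ ⟶ Δ`. -/
def IsRaagMap {G H : ACCoalgebra.{u}} (p : GraphPresentation G) (q : GraphPresentation H)
    (f : G.A ⟶ H.A) : Prop :=
  ∃ φ : p.graph ⟶ q.graph, p.iso.hom.f ≫ f = raagFunctor.map φ ≫ q.iso.hom.f

/-! ### Finite descriptions of the data -/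

/-- A word in letters from `α` and their formal inverses; `(a, true)` is the letter `a` and
`(a, false)` is its inverse. -/
abbrev GWord (α : Type) : Type := List (α × Bool)

/-- The element of `G` that a word describes, when the letter `a` stands for `x a`. -/
def GWord.eval {α : Type} {G : Type u} [Group G] (x : α → G) (w : GWord α) : G :=
  FreeGroup.lift x (FreeGroup.mk w)

/-- A word `[w₁]^{±1} ⋯ [wₖ]^{±1}` in the formal generators of `AC G`, where each `wⱼ` is itself a
word in the letters `α`. -/
abbrev ACWord (α : Type) : Type := GWord (GWord α)

/-- The element of `AC G` that such a word describes, when the letter `a` stands for `x a`. -/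
def ACWord.eval {α : Type} {G : GrpCat.{u}} (x : α → G) (W : ACWord α) : acComonad.obj G :=
  GWord.eval (G := Raag (commutationGraph G))
    (fun w : GWord α => Raag.of (Γ := commutationGraph G) (GWord.eval x w)) W

/-- `⟨x₁, …, xₙ | rels⟩` is a presentation of the group `G`. -/
def Presents {n : ℕ} {G : Type u} [Group G] (x : Fin n → G) (rels : List (GWord (Fin n))) : Prop :=
  Function.Surjective (FreeGroup.lift x) ∧
    (FreeGroup.lift x).ker = Subgroup.normalClosure {r | ∃ w ∈ rels, r = FreeGroup.mk w}

/-- A finite description of a homomorphism between finitely presented groups with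
`AC`-coalgebra structures: finite presentations of both groups, the values of both structure maps
on the generators, and the values of the homomorphism on the generators, all given by words. -/
structure InputData where
  n : ℕ
  relsG : List (GWord (Fin n))
  coactG : Fin n → ACWord (Fin n)
  m : ℕ
  relsH : List (GWord (Fin m))
  coactH : Fin m → ACWord (Fin m)
  map : Fin n → GWord (Fin m)

/-- `d` describes `f : G ⟶ H` together with the coalgebras `G` and `H`, where the letters of `d`
stand for the generators `x` of `G` and `y` of `H`. -/
structure InputData.Describes (d : InputData) {G H : ACCoalgebra.{u}} (f : G.A ⟶ H.A)
    (x : Fin d.n → G.A) (y : Fin d.m → H.A) : Prop where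
  presG : Presents x d.relsG
  presH : Presents y d.relsH
  coactG : ∀ i, G.a.hom (x i) = ACWord.eval x (d.coactG i)
  coactH : ∀ j, H.a.hom (y j) = ACWord.eval y (d.coactH j)
  map : ∀ i, f.hom (x i) = GWord.eval y (d.map i)

/-- Rename the letters of a word. -/
def GWord.rename {α β : Type} (e : α → β) (w : GWord α) : GWord β :=
  w.map (Prod.map e id)

/-- The type of the finite strings that the algorithm reads. -/
abbrev InputCode : Type :=
  (ℕ × List (GWord ℕ) × List (ACWord ℕ)) × (ℕ × List (GWord ℕ) × List (ACWord ℕ)) × List (GWord ℕ)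

/-- The input as the algorithm reads it: letters are replaced by their numbers, and the values on
the generators are listed in order. -/
def InputData.code (d : InputData) : InputCode :=
  ((d.n, d.relsG.map (GWord.rename Fin.val),
      List.ofFn fun i => GWord.rename (GWord.rename Fin.val) (d.coactG i)),
    (d.m, d.relsH.map (GWord.rename Fin.val),
      List.ofFn fun j => GWord.rename (GWord.rename Fin.val) (d.coactH j)),
    List.ofFn fun i => GWord.rename Fin.val (d.map i))

/-! Call an element `g` of a coalgebra with structure map `c` group-like if `c g = [g]`.
Coassociativity says that every value of `c` is equalized by `A (C c)` and `A η`, and these two maps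
have the common retraction `A (C ε)`. Killing vertices outside a set is an endomorphism of a
right-angled Artin group; composing two such endomorphisms shows that anything equalized by a
coreflexive pair of this kind lies in the subgroup generated by the vertices where the two graph
maps agree (`mem_closure_of_map_eq`). Here these vertices are the `[h]` with `h` group-like. Hence
the group is the right-angled Artin group on its group-like elements, and in every presenting graph
the vertices are exactly the group-like elements. As vertices commute only when adjacent, `f` is
some `A φ` iff it preserves group-like elements (`isRaagMap_iff`), a criterion that does not depend
on the graphs.

The criterion is effective. An element `g` is group-like iff `[g]` has nonzero exponent sum in `c x`
for some generator `x` (`mem_groupLike_iff`). So all group-like elements occur among the finitely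
many letters of the words given for `c`, and computing exponent sums needs only a solution of the
word problem.

The word problem is solved uniformly by a double search: for an expression of the word as a product
of conjugates of relators, and for a finite permutation action that satisfies the relators but moves
a point under the word. The second search succeeds on nontrivial elements because right-angled Artin
groups are residually finite (`exists_perm_ne_one`), which is proved by letting `A Γ` act on
fillings of a reduced expression. -/

namespace Raag

/-! ### Retractions and exponent sums of right-angled Artin groups -/

/-- The universal property of `A Γ`, for target groups in an arbitrary universe. -/
def liftAny {Γ : Gph.{u}} {G : Type*} [Group G] (x : Γ.V → G)
    (hx : ∀ v w, Γ.Adj v w → x v * x w = x w * x v) : Raag Γ →* G :=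
  PresentedGroup.toGroup (f := x) (by
    rintro r ⟨v, w, hvw, rfl⟩
    rw [map_commutatorElement, FreeGroup.lift_apply_of, FreeGroup.lift_apply_of,
      commutatorElement_eq_one_iff_mul_comm]
    exact hx v w hvw)

theorem liftAny_of {Γ : Gph.{u}} {G : Type*} [Group G] (x : Γ.V → G)
    (hx : ∀ v w, Γ.Adj v w → x v * x w = x w * x v) (v : Γ.V) : liftAny x hx (of v) = x v :=
  PresentedGroup.toGroup.of _

theorem closure_range_of (Γ : Gph.{u}) :
    Subgroup.closure (Set.range (of : Γ.V → Raag Γ)) = ⊤ :=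
  PresentedGroup.closure_range_of _

theorem map_comp_apply {Γ Δ Θ : Gph.{u}} (φ : Γ ⟶ Δ) (ψ : Δ ⟶ Θ) (z : Raag Γ) :
    map ψ (map φ z) = map (φ ≫ ψ) z := by
  have : (map ψ).comp (map φ) = map (φ ≫ ψ) := hom_ext fun v => by
    rw [MonoidHom.comp_apply, map_of, map_of, map_of]; rfl
  exact DFunLike.congr_fun this z

theorem map_eq_self {Γ : Gph.{u}} (φ : Γ ⟶ Γ) (h : ∀ v, φ.toFun v = v) (z : Raag Γ) :
    map φ z = z := by
  have : map φ = MonoidHom.id _ := hom_ext fun v => by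
    rw [map_of, h]; rfl
  exact DFunLike.congr_fun this z

theorem map_mem_closure {Γ Δ : Gph.{u}} (φ : Γ ⟶ Δ) (z : Raag Γ) :
    map φ z ∈ Subgroup.closure (of '' Set.range φ.toFun) := by
  have hz : z ∈ Subgroup.closure (Set.range (of : Γ.V → Raag Γ)) := by
    rw [closure_range_of]; trivial
  have h := Subgroup.mem_map_of_mem (map φ) hz
  rw [MonoidHom.map_closure] at h
  refine Subgroup.closure_mono ?_ h
  rintro _ ⟨_, ⟨v, rfl⟩, rfl⟩
  exact ⟨_, ⟨v, rfl⟩, (map_of φ v).symm⟩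

open Classical in
/-- The endomorphism of `A Γ` that fixes the vertices in `S` and kills the others. -/
noncomputable def proj {Γ : Gph.{u}} (S : Set Γ.V) : Raag Γ →* Raag Γ :=
  lift (fun v => if v ∈ S then of v else 1) fun v w h => by
    split_ifs <;> simp [of_comm h]

theorem proj_of_mem {Γ : Gph.{u}} {S : Set Γ.V} {v : Γ.V} (h : v ∈ S) :
    proj S (of v) = of v := by
  rw [proj, lift_of, if_pos h]

theorem proj_of_notMem {Γ : Gph.{u}} {S : Set Γ.V} {v : Γ.V} (h : v ∉ S) :
    proj S (of v) = 1 := by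
  rw [proj, lift_of, if_neg h]

theorem proj_eq_self {Γ : Gph.{u}} {S : Set Γ.V} {z : Raag Γ}
    (hz : z ∈ Subgroup.closure (of '' S)) : proj S z = z := by
  induction hz using Subgroup.closure_induction with
  | mem x hx => obtain ⟨v, hv, rfl⟩ := hx; exact proj_of_mem hv
  | one => exact map_one _
  | mul x y _ _ hx hy => rw [map_mul, hx, hy]
  | inv x _ hx => rw [map_inv, hx]

/-- The composite kills every vertex outside `S ∩ T`. Consequently an element fixed by both
projections lies in the subgroup generated by `S ∩ T`. -/
theorem proj_proj_mem_closure {Γ : Gph.{u}} (S T : Set Γ.V) (z : Raag Γ) :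
    proj S (proj T z) ∈ Subgroup.closure (of '' (S ∩ T)) := by
  have hz : z ∈ Subgroup.closure (Set.range (of : Γ.V → Raag Γ)) := by
    rw [closure_range_of]; trivial
  induction hz using Subgroup.closure_induction with
  | mem x hx =>
    obtain ⟨v, rfl⟩ := hx
    by_cases hT : v ∈ T
    · rw [proj_of_mem hT]
      by_cases hS : v ∈ S
      · rw [proj_of_mem hS]; exact Subgroup.subset_closure ⟨v, ⟨hS, hT⟩, rfl⟩
      · rw [proj_of_notMem hS]; exact one_mem _
    · rw [proj_of_notMem hT, map_one]; exact one_mem _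
  | one => rw [map_one, map_one]; exact one_mem _
  | mul x y _ _ hx hy => rw [map_mul, map_mul]; exact mul_mem hx hy
  | inv x _ hx => rw [map_inv, map_inv]; exact inv_mem hx

/-- The functor `A` preserves the equalizers of coreflexive pairs, as far as generators go. -/
theorem mem_closure_of_map_eq {X Y : Gph.{u}} (p q : X ⟶ Y) (r : Y ⟶ X)
    (hp : ∀ v, r.toFun (p.toFun v) = v) (hq : ∀ v, r.toFun (q.toFun v) = v) {z : Raag X}
    (hz : map p z = map q z) : z ∈ Subgroup.closure (of '' {v | p.toFun v = q.toFun v}) := by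
  have h1 : proj (Set.range p.toFun) (map p z) = map p z := proj_eq_self (map_mem_closure p z)
  have h2 : proj (Set.range q.toFun) (map p z) = map p z := by
    rw [hz]; exact proj_eq_self (map_mem_closure q z)
  have h3 := proj_proj_mem_closure (Set.range p.toFun) (Set.range q.toFun) (map p z)
  rw [h2, h1] at h3
  -- `map p z` is now generated by vertices `y` in both ranges. Applying `r` recovers `z`, and if `y
  -- = p a = q b` then `r y = a = b`, so `p` and `q` agree at `r y`.
  have h4 := Subgroup.mem_map_of_mem (map r) h3
  rw [MonoidHom.map_closure, map_comp_apply, map_eq_self _ hp] at h4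
  refine Subgroup.closure_mono ?_ h4
  rintro _ ⟨_, ⟨y, ⟨⟨a, ha⟩, ⟨b, hb⟩⟩, rfl⟩, rfl⟩
  refine ⟨r.toFun y, ?_, (map_of r y).symm⟩
  have e1 : r.toFun y = a := by rw [← ha, hp]
  have e2 : r.toFun y = b := by rw [← hb, hq]
  change p.toFun (r.toFun y) = q.toFun (r.toFun y)
  rw [e1, ha, ← e1, e2, hb]

open Classical in
/-- The exponent sum of the vertex `v`. -/
noncomputable def expSum {Γ : Gph.{u}} (v : Γ.V) : Raag Γ →* Multiplicative ℤ :=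
  liftAny (fun w => if w = v then Multiplicative.ofAdd 1 else 1) fun _ _ _ => mul_comm _ _

open Classical in
theorem expSum_of {Γ : Gph.{u}} (v w : Γ.V) :
    expSum v (of w) = if w = v then Multiplicative.ofAdd 1 else 1 :=
  liftAny_of _ _ w

theorem expSum_of_self_ne_one {Γ : Gph.{u}} (v : Γ.V) : expSum v (of v) ≠ 1 := by
  rw [expSum_of, if_pos rfl]; decide

theorem expSum_eq_one_of_mem_closure {Γ : Gph.{u}} {v : Γ.V} {S : Set Γ.V} (hv : v ∉ S)
    {z : Raag Γ} (hz : z ∈ Subgroup.closure (of '' S)) : expSum v z = 1 := by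
  have : Subgroup.closure (of '' S) ≤ (expSum v).ker := by
    rw [Subgroup.closure_le]
    rintro _ ⟨w, hw, rfl⟩
    change expSum v (of w) = 1
    rw [expSum_of, if_neg]
    rintro rfl; exact hv hw
  exact this hz

-- If `v` and `w` are not adjacent, they can be sent to two non-commuting transpositions of three
-- points and all other vertices to `1`; this respects the relations.
open Classical in
theorem adj_of_of_comm {Γ : Gph.{u}} {v w : Γ.V} (h : (of v * of w : Raag Γ) = of w * of v) :
    Γ.Adj v w := by
  by_contra hvw
  have hne : v ≠ w := by rintro rfl; exact hvw (Γ.refl v)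
  let x : Γ.V → Equiv.Perm (Fin 3) := fun a =>
    if a = v then Equiv.swap 0 1 else if a = w then Equiv.swap 1 2 else 1
  have hx : ∀ a b, Γ.Adj a b → x a * x b = x b * x a := by
    intro a b hab
    simp only [x]
    by_cases h1 : a = v <;> by_cases h2 : b = v <;> by_cases h3 : a = w <;> by_cases h4 : b = w
      <;> simp only [h1, h2, h3, h4, if_true, if_false, mul_one, one_mul]
      <;> first
        | rfl
        | (subst_vars; exact absurd hab hvw)
        | (subst_vars; exact absurd (Γ.symm _ _ hab) hvw)
  have h' := congrArg (liftAny x hx) h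
  rw [map_mul, map_mul, liftAny_of, liftAny_of] at h'
  simp only [x, if_true, if_neg hne.symm] at h'
  revert h'; decide

end Raag

/-! ### Group-like elements -/

section Coalgebra

variable {G : Type u} [Group G]

/-- The graph homomorphism `C f` induced by a group homomorphism `f`. -/
def commutationMap {H : Type u} [Group H] (f : G →* H) :
    commutationGraph G ⟶ commutationGraph H where
  toFun := f
  map_adj g h (hgh : g * h = h * g) :=
    (map_mul f g h).symm.trans ((congrArg f hgh).trans (map_mul f h g))

/-- The elements `g` at which the structure map `c` takes the value `[g]`. -/
def groupLike (c : G →* Raag (commutationGraph G)) : Set G :=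
  {g | c g = Raag.of (Γ := commutationGraph G) g}

/-- The full subgraph of `C G` on the group-like elements. -/
def groupLikeGraph (c : G →* Raag (commutationGraph G)) : Gph.{u} where
  V := groupLike c
  Adj g h := (g : G) * h = h * g
  symm _ _ h := h.symm
  refl _ := rfl

variable {c : G →* Raag (commutationGraph G)}

/-- Coassociativity puts `c g` in the equalizer of the pair induced by `c` and `η`, and the counit
is a common retraction on vertices. The vertices where `c` and `η` agree are by definition the
group-like elements. -/
theorem mem_closure_groupLike (hε : ∀ g, raagCounit G (c g) = g)
    (hδ : ∀ g, Raag.map (raagUnit (commutationGraph G)) (c g) = Raag.map (commutationMap c) (c g))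
    (g : G) : c g ∈ Subgroup.closure
      ((Raag.of : (commutationGraph G).V → Raag (commutationGraph G)) '' groupLike c) :=
  Raag.mem_closure_of_map_eq (commutationMap c) (raagUnit (commutationGraph G))
    (commutationMap (raagCounit G)) hε (fun g => raagCounit_of g) (hδ g).symm

/-- An element is group-like iff its exponent sum does not vanish on the image of the structure
map, which can be tested on generators. -/
theorem mem_groupLike_iff (hε : ∀ g, raagCounit G (c g) = g)
    (hδ : ∀ g, Raag.map (raagUnit (commutationGraph G)) (c g) = Raag.map (commutationMap c) (c g))
    {ι : Type*} {x : ι → G} (hx : Function.Surjective (FreeGroup.lift x)) (g : G) :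
    g ∈ groupLike c ↔ ∃ i, Raag.expSum (Γ := commutationGraph G) g (c (x i)) ≠ 1 := by
  constructor
  · intro hg
    by_contra! h
    -- A homomorphism trivial on the generators is trivial, but this one takes the exponent sum of
    -- `[g]` in `c g = [g]`.
    have : ((Raag.expSum (Γ := commutationGraph G) g).comp c).comp (FreeGroup.lift x) = 1 := by
      ext i; simpa using h i
    obtain ⟨z, hz⟩ := hx g
    have h1 := DFunLike.congr_fun this z
    simp only [MonoidHom.comp_apply, hz, MonoidHom.one_apply] at h1
    rw [show c g = _ from hg] at h1
    exact Raag.expSum_of_self_ne_one _ h1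
  · rintro ⟨i, hi⟩
    by_contra hg
    exact hi (Raag.expSum_eq_one_of_mem_closure hg (mem_closure_groupLike hε hδ (x i)))

/-- The canonical homomorphism from the right-angled Artin group on the group-like elements. -/
def groupLikeHom (c : G →* Raag (commutationGraph G)) : Raag (groupLikeGraph c) →* G :=
  Raag.lift (Γ := groupLikeGraph c) (fun g => (g.1 : G)) fun _ _ h => h

theorem groupLikeHom_of (g : (groupLikeGraph c).V) :
    groupLikeHom c (Raag.of (Γ := groupLikeGraph c) g) = g.1 :=
  Raag.lift_of (Γ := groupLikeGraph c) _ _ g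

-- For injectivity, `c` followed by the map that kills the vertices that are not group-like is a
-- left inverse. For surjectivity, `g = ε (c g)`, and `c g` is generated by group-like vertices.
open Classical in
theorem groupLikeHom_bijective (hε : ∀ g, raagCounit G (c g) = g)
    (hδ : ∀ g, Raag.map (raagUnit (commutationGraph G)) (c g) =
      Raag.map (commutationMap c) (c g)) :
    Function.Bijective (groupLikeHom c) := by
  constructor
  · let r : Raag (commutationGraph G) →* Raag (groupLikeGraph c) :=
      Raag.lift (Γ := commutationGraph G)
        (fun g => if h : g ∈ groupLike c then Raag.of (Γ := groupLikeGraph c) ⟨g, h⟩ else 1)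
        fun g h hgh => by
          split_ifs
          · exact Raag.of_comm (Γ := groupLikeGraph c) hgh
          all_goals simp
    have hr : (r.comp c).comp (groupLikeHom c) = MonoidHom.id _ := Raag.hom_ext fun g => by
      rw [MonoidHom.comp_apply, MonoidHom.comp_apply, groupLikeHom_of, show c g.1 = _ from g.2]
      refine (Raag.lift_of (Γ := commutationGraph G) _ _ g.1).trans ?_
      rw [dif_pos g.2]; rfl
    exact Function.LeftInverse.injective (g := r.comp c) fun z => DFunLike.congr_fun hr z
  · intro g
    have h1 := Subgroup.mem_map_of_mem (raagCounit G) (mem_closure_groupLike hε hδ g)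
    rw [hε, MonoidHom.map_closure] at h1
    have h2 : Subgroup.closure (raagCounit G ''
        ((Raag.of : (commutationGraph G).V → Raag (commutationGraph G)) '' groupLike c)) ≤
        (groupLikeHom c).range := by
      rw [Subgroup.closure_le]
      rintro _ ⟨_, ⟨v, hv, rfl⟩, rfl⟩
      exact ⟨_, (groupLikeHom_of ⟨v, hv⟩).trans (raagCounit_of v).symm⟩
    exact h2 h1

/-- The image of `A η` involves only the letters `[v]` with `v` a vertex, whereas `[z]` has exponent
sum one in the letter `[z]`. This says that `A Γ` has no group-like elements besides its vertices.
-/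
theorem Raag.mem_range_of_of_map_unit {Γ : Gph.{u}} {z : Raag Γ}
    (hz : Raag.map (raagUnit Γ) z = Raag.of (Γ := commutationGraph (Raag Γ)) z) :
    ∃ v, Raag.of v = z := by
  by_contra h
  have h1 := Raag.expSum_eq_one_of_mem_closure (v := z) (S := Set.range (raagUnit Γ).toFun) h
    (Raag.map_mem_closure (raagUnit Γ) z)
  rw [hz] at h1
  exact Raag.expSum_of_self_ne_one _ h1

end Coalgebra

/-! ### Graph presentations and the criterion for being some `A φ` -/

namespace ACCoalgebra

/-- The structure map of a coalgebra as a homomorphism of groups. -/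
def coact (G : ACCoalgebra.{u}) : G.A →* Raag (commutationGraph G.A) := G.a.hom

theorem counit_coact (G : ACCoalgebra.{u}) (g : G.A) : raagCounit G.A (G.coact g) = g :=
  DFunLike.congr_fun (congrArg GrpCat.Hom.hom G.counit) g

theorem coassoc_coact (G : ACCoalgebra.{u}) (g : G.A) :
    Raag.map (raagUnit (commutationGraph G.A)) (G.coact g) =
      Raag.map (commutationMap G.coact) (G.coact g) :=
  DFunLike.congr_fun (congrArg GrpCat.Hom.hom G.coassoc) g

theorem coact_hom {G H : ACCoalgebra.{u}} (f : G ⟶ H) (g : G.A) :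
    Raag.map (commutationMap f.f.hom) (G.coact g) = H.coact (f.f.hom g) :=
  DFunLike.congr_fun (congrArg GrpCat.Hom.hom f.h) g

theorem map_mem_groupLike {G H : ACCoalgebra.{u}} (f : G ⟶ H) {g : G.A}
    (hg : g ∈ groupLike G.coact) : f.f.hom g ∈ groupLike H.coact := by
  change H.coact _ = _
  rw [← coact_hom, show G.coact g = _ from hg]
  exact Raag.map_of (commutationMap f.f.hom) g

theorem nonempty_graphPresentation (G : ACCoalgebra.{u}) : Nonempty (GraphPresentation G) := by
  let e : Raag (groupLikeGraph G.coact) ≃* G.A :=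
    MulEquiv.ofBijective _ (groupLikeHom_bijective G.counit_coact G.coassoc_coact)
  refine ⟨⟨groupLikeGraph G.coact, Comonad.Coalgebra.isoMk e.toGrpIso ?_⟩⟩
  refine GrpCat.hom_ext (Raag.hom_ext (Γ := groupLikeGraph G.coact) fun v => ?_)
  change Raag.map (commutationMap e.toMonoidHom) (Raag.map (raagUnit _) (Raag.of v)) =
    G.coact (groupLikeHom G.coact (Raag.of v))
  rw [Raag.map_of, groupLikeHom_of, show G.coact v.1 = _ from v.2]
  refine (Raag.map_of (commutationMap e.toMonoidHom) _).trans ?_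
  exact congrArg _ (groupLikeHom_of v)

end ACCoalgebra

namespace GraphPresentation

variable {G : ACCoalgebra.{u}} (p : GraphPresentation G)

/-- The isomorphism of groups that underlies a graph presentation. -/
def hom : Raag p.graph →* G.A := p.iso.hom.f.hom

/-- The inverse of `GraphPresentation.hom`. -/
def inv : G.A →* Raag p.graph := p.iso.inv.f.hom

theorem inv_hom (z : Raag p.graph) : p.inv (p.hom z) = z :=
  congrArg (fun f : (Comonad.comparison raagAdjunction).obj p.graph ⟶ _ => f.f.hom z)
    p.iso.hom_inv_id

theorem hom_inv (g : G.A) : p.hom (p.inv g) = g :=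
  congrArg (fun f : G ⟶ G => f.f.hom g) p.iso.inv_hom_id

/-- Coalgebra isomorphisms carry group-like elements to group-like elements in both directions, so
it is enough to know those of `A Γ`. -/
theorem mem_groupLike_iff (g : G.A) : g ∈ groupLike G.coact ↔ ∃ v, p.hom (Raag.of v) = g := by
  constructor
  · intro hg
    obtain ⟨v, hv⟩ := Raag.mem_range_of_of_map_unit
      (ACCoalgebra.map_mem_groupLike p.iso.inv hg : Raag.map (raagUnit p.graph) (p.inv g) = _)
    exact ⟨v, (congrArg p.hom hv).trans (p.hom_inv g)⟩
  · rintro ⟨v, rfl⟩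
    exact ACCoalgebra.map_mem_groupLike p.iso.hom (Raag.map_of (raagUnit p.graph) v)

end GraphPresentation

/-- Vertices correspond to group-like elements on both sides, so preserving these yields a map of
vertices. It preserves adjacency because `f` preserves commutation and commuting vertices of a
right-angled Artin group are adjacent. -/
theorem isRaagMap_iff {G H : ACCoalgebra.{u}} (p : GraphPresentation G) (q : GraphPresentation H)
    (f : G.A ⟶ H.A) :
    IsRaagMap p q f ↔ ∀ g ∈ groupLike G.coact, f.hom g ∈ groupLike H.coact := by
  constructor
  · rintro ⟨φ, hφ⟩ g hg
    obtain ⟨v, rfl⟩ := (p.mem_groupLike_iff g).1 hg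
    refine (q.mem_groupLike_iff _).2 ⟨φ.toFun v, ?_⟩
    rw [← Raag.map_of]
    exact (DFunLike.congr_fun (congrArg GrpCat.Hom.hom hφ) (Raag.of v)).symm
  · intro h
    have h' : ∀ v, ∃ w, q.hom (Raag.of w) = f.hom (p.hom (Raag.of v)) := fun v =>
      (q.mem_groupLike_iff _).1 (h _ ((p.mem_groupLike_iff _).2 ⟨v, rfl⟩))
    choose φ hφ using h'
    have hq : ∀ v, (Raag.of (φ v) : Raag q.graph) = q.inv (f.hom (p.hom (Raag.of v))) := fun v => by
      rw [← hφ, q.inv_hom]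
    refine ⟨⟨φ, fun v w hvw => Raag.adj_of_of_comm ?_⟩, ?_⟩
    · rw [hq, hq, ← map_mul, ← map_mul, ← map_mul, Raag.of_comm hvw, map_mul, map_mul, map_mul]
    · refine GrpCat.hom_ext (Raag.hom_ext fun v => ?_)
      change f.hom (p.hom (Raag.of v)) = q.hom (Raag.map _ (Raag.of v))
      rw [Raag.map_of, hφ]

/-! ### Reduced lists of syllables -/

namespace Raag

variable {Γ : Gph.{u}}

/-- The element of `A Γ` described by a list of syllables, that is, of powers of vertices. -/
def syllableProd (L : List (Γ.V × ℤ)) : Raag Γ := (L.map fun s => of s.1 ^ s.2).prod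

theorem syllableProd_append (L M : List (Γ.V × ℤ)) :
    syllableProd (L ++ M) = syllableProd L * syllableProd M := by
  simp [syllableProd]

theorem syllableProd_cons (s : Γ.V × ℤ) (L : List (Γ.V × ℤ)) :
    syllableProd (s :: L) = of s.1 ^ s.2 * syllableProd L := by
  simp [syllableProd]

theorem exists_syllableProd_eq (z : Raag Γ) : ∃ L : List (Γ.V × ℤ), syllableProd L = z := by
  have hz : z ∈ Subgroup.closure (Set.range (of : Γ.V → Raag Γ)) := by
    rw [closure_range_of]; trivial
  induction hz using Subgroup.closure_induction with
  | mem x hx => obtain ⟨v, rfl⟩ := hx; exact ⟨[(v, 1)], by simp [syllableProd]⟩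
  | one => exact ⟨[], rfl⟩
  | mul x y _ _ hx hy =>
    obtain ⟨L, rfl⟩ := hx
    obtain ⟨M, rfl⟩ := hy
    exact ⟨L ++ M, syllableProd_append L M⟩
  | inv x _ hx =>
    obtain ⟨L, rfl⟩ := hx
    refine ⟨(L.map fun s => (s.1, -s.2)).reverse, ?_⟩
    rw [syllableProd, syllableProd, List.prod_inv_reverse, List.map_reverse, List.map_map,
      List.map_map]
    simp [Function.comp_def]

theorem commute_syllableProd {v : Γ.V} {L : List (Γ.V × ℤ)} (h : ∀ s ∈ L, Γ.Adj v s.1) :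
    Commute (of v : Raag Γ) (syllableProd L) := by
  refine Commute.list_prod_right _ _ fun x hx => ?_
  obtain ⟨s, hs, rfl⟩ := List.mem_map.1 hx
  exact Commute.zpow_right (of_comm (h s hs)) _

/-- A list of syllables is reduced if no exponent vanishes and no two syllables can be merged. -/
structure IsReduced (L : List (Γ.V × ℤ)) : Prop where
  ne_zero : ∀ s ∈ L, s.2 ≠ 0
  separated : ∀ i j : Fin L.length, i < j → L[i].1 = L[j].1 →
    ∃ m, i < m ∧ m < j ∧ ¬ Γ.Adj L[i].1 L[m].1

/-- A list of minimal length among those representing `z` is reduced: a zero syllable could be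
dropped, and two syllables with nothing blocking them could be merged. -/
theorem exists_isReduced (z : Raag Γ) :
    ∃ L : List (Γ.V × ℤ), IsReduced L ∧ syllableProd L = z := by
  classical
  have hex : ∃ k, ∃ L : List (Γ.V × ℤ), L.length = k ∧ syllableProd L = z := by
    obtain ⟨L, hL⟩ := exists_syllableProd_eq z
    exact ⟨_, L, rfl, hL⟩
  obtain ⟨L, hk, hL⟩ := Nat.find_spec hex
  have hmin : ∀ M : List (Γ.V × ℤ), syllableProd M = z → L.length ≤ M.length := fun M hM =>
    hk.le.trans (Nat.find_min' hex ⟨M, rfl, hM⟩)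
  refine ⟨L, ⟨?_, ?_⟩, hL⟩
  · intro s hs h0
    obtain ⟨A, B, rfl⟩ := List.append_of_mem hs
    have := hmin (A ++ B) (by
      rw [← hL, syllableProd_append, syllableProd_append, syllableProd_cons, h0, zpow_zero,
        one_mul])
    simp at this
  · intro i j hij hlab
    by_contra! hadj
    -- Cut `L` around the positions `i` and `j`, so that syllable `j` can be moved left across the
    -- commuting stretch and merged into syllable `i`.
    have e1 : L = L.take i ++ L[i] :: L.drop (i + 1) := by simp
    set X := L.drop (i + 1) with hX
    have hlt : (j : ℕ) - i - 1 < X.length := by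
      rw [hX, List.length_drop]; have := j.2; have : (i : ℕ) < j := hij; omega
    have e2 : X = X.take (j - i - 1) ++ X[(j : ℕ) - i - 1] :: X.drop (j - i - 1 + 1) := by simp
    have e3 : X[(j : ℕ) - i - 1] = L[j] := by
      have : (i : ℕ) < j := hij
      simp only [hX, List.getElem_drop, Fin.getElem_fin]
      congr 1; omega
    rw [e3] at e2
    have hcomm : Commute (of L[i].1 : Raag Γ) (syllableProd (X.take (j - i - 1))) := by
      refine commute_syllableProd fun s hs => ?_
      obtain ⟨m, hm, rfl⟩ := List.mem_iff_getElem.1 hs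
      have hm' : m < (j : ℕ) - i - 1 := by
        rw [List.length_take] at hm; omega
      have hmL : (i : ℕ) + 1 + m < L.length := by have := j.2; omega
      have := hadj ⟨i + 1 + m, hmL⟩ (Fin.lt_def.2 (by simp; omega)) (Fin.lt_def.2 (by simp; omega))
      simpa [hX] using this
    have key := hmin (L.take i ++ (L[i].1, L[i].2 + L[j].2) ::
      (X.take (j - i - 1) ++ X.drop (j - i - 1 + 1))) (by
        refine Eq.trans ?_ hL
        conv_rhs => rw [e1, e2]
        simp only [syllableProd_append, syllableProd_cons, ← hlab]
        rw [zpow_add, mul_assoc, ← mul_assoc (of L[i].1 ^ L[j].2),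
          (hcomm.zpow_left _).eq, mul_assoc])
    have l1 := congrArg List.length e1
    have l2 := congrArg List.length e2
    simp only [List.length_append, List.length_cons] at key l1 l2
    omega

/-! ### The action of `A Γ` on the fillings of a reduced list of syllables -/

section Filling

variable {k N : ℕ} (a : Fin k → Γ.V) (t : Fin k → ZMod N)

/-- The syllable `i` is active in the filling `c` if all later syllables that do not commute with it
are full, and all earlier ones are empty. -/
def IsActive (c : Fin k → ZMod N) (i : Fin k) : Prop :=
  ∀ m, m ≠ i → (a i = a m ∨ ¬ Γ.Adj (a i) (a m)) → c m = if m < i then 0 else t m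

open Classical in
/-- Add `e` to the content of the active syllable with label `v`, if there is one. -/
noncomputable def fill (v : Γ.V) (e : ZMod N) (c : Fin k → ZMod N) : Fin k → ZMod N :=
  fun m => if a m = v ∧ IsActive a t c m then c m + e else c m

variable {a t}

theorem fill_apply_of_ne {v : Γ.V} {m : Fin k} (h : a m ≠ v) (e : ZMod N) (c : Fin k → ZMod N) :
    fill a t v e c m = c m :=
  if_neg fun h' => h h'.1

open Classical in
theorem fill_apply_self (m : Fin k) (e : ZMod N) (c : Fin k → ZMod N) :
    fill a t (a m) e c m = if IsActive a t c m then c m + e else c m :=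
  if_congr (and_iff_right rfl) rfl rfl

theorem fill_zero (v : Γ.V) (c : Fin k → ZMod N) : fill a t v 0 c = c := by
  funext m; simp [fill]

/-- Filling at `v` alters only syllables labelled `v`, and the activity of `m` does not depend on
syllables with a different, adjacent label. -/
theorem isActive_fill_of_adj {v : Γ.V} {m : Fin k} (hne : a m ≠ v) (hadj : Γ.Adj (a m) v)
    (e : ZMod N) (c : Fin k → ZMod N) : IsActive a t (fill a t v e c) m ↔ IsActive a t c m := by
  refine forall_congr' fun m' => imp_congr_right fun _ => imp_congr_right fun hdep => ?_
  have : a m' ≠ v := by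
    rintro rfl
    exact hdep.elim hne fun h => h hadj
  rw [fill_apply_of_ne this]

theorem fill_comm {v w : Γ.V} (hne : v ≠ w) (hadj : Γ.Adj v w) (e e' : ZMod N)
    (c : Fin k → ZMod N) :
    fill a t v e (fill a t w e' c) = fill a t w e' (fill a t v e c) := by
  funext m
  by_cases hv : a m = v
  · subst hv
    rw [fill_apply_of_ne hne, fill_apply_self, fill_apply_self, fill_apply_of_ne hne]
    rw [propext (isActive_fill_of_adj (t := t) hne hadj e' c)]
  · rw [fill_apply_of_ne hv]
    by_cases hw : a m = w
    · subst hw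
      rw [fill_apply_self, fill_apply_self, fill_apply_of_ne hv]
      rw [propext (isActive_fill_of_adj (t := t) hv (Γ.symm _ _ hadj) e c)]
    · rw [fill_apply_of_ne hw, fill_apply_of_ne hw, fill_apply_of_ne hv]

variable (ht : ∀ m, t m ≠ 0)
  (hsep : ∀ i j, i < j → a i = a j → ∃ m, i < m ∧ m < j ∧ ¬ Γ.Adj (a i) (a m))

-- Of two active syllables with equal labels, the earlier one requires a separating syllable between
-- them to be full and the later one requires it to be empty. These conflict because `t` never
-- vanishes.
include ht hsep in
theorem IsActive.unique {c : Fin k → ZMod N} {i j : Fin k} (hi : IsActive a t c i)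
    (hj : IsActive a t c j) (hij : a i = a j) : i = j := by
  have main : ∀ i j, IsActive a t c i → IsActive a t c j → a i = a j → ¬ i < j := by
    intro i j hi hj hij hlt
    obtain ⟨m, h1, h2, h3⟩ := hsep i j hlt hij
    have e1 := hi m h1.ne' (Or.inr h3)
    have e2 := hj m h2.ne (Or.inr (hij ▸ h3))
    rw [if_neg h1.not_gt] at e1
    rw [if_pos h2] at e2
    exact ht m (e1.symm.trans e2)
  rcases lt_trichotomy i j with h | h | h
  · exact absurd h (main i j hi hj hij)
  · exact h
  · exact absurd h (main j i hj hi hij.symm)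

include ht hsep in
theorem fill_of_isActive {c : Fin k → ZMod N} {i : Fin k} (hi : IsActive a t c i) (e : ZMod N) :
    fill a t (a i) e c = Function.update c i (c i + e) := by
  funext m
  by_cases hm : m = i
  · subst hm; rw [Function.update_self, fill, if_pos ⟨rfl, hi⟩]
  · rw [Function.update_of_ne hm, fill, if_neg]
    rintro ⟨h1, h2⟩
    exact hm (IsActive.unique ht hsep h2 hi h1)

-- Filling changes only the content of the unique active syllable with this label, and a syllable's
-- activity ignores its own content.
include ht hsep in
theorem isActive_fill_self (m : Fin k) (e : ZMod N) (c : Fin k → ZMod N) :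
    IsActive a t (fill a t (a m) e c) m ↔ IsActive a t c m := by
  have key : ∀ i, IsActive a t c i → IsActive a t (fill a t (a i) e c) i := by
    intro i hi m' hm' hdep
    rw [fill_of_isActive ht hsep hi, Function.update_of_ne hm']
    exact hi m' hm' hdep
  refine ⟨fun h => ?_, key m⟩
  by_cases hex : ∃ i, a i = a m ∧ IsActive a t c i
  · obtain ⟨i, hlab, hi⟩ := hex
    have := key i hi
    rw [hlab] at this
    rwa [← IsActive.unique ht hsep this h hlab]
  · have : fill a t (a m) e c = c := by
      funext i
      exact if_neg fun h => hex ⟨i, h⟩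
    rwa [this] at h

include ht hsep in
theorem fill_fill (v : Γ.V) (e e' : ZMod N) (c : Fin k → ZMod N) :
    fill a t v e (fill a t v e' c) = fill a t v (e' + e) c := by
  funext m
  by_cases hv : a m = v
  · subst hv
    by_cases hm : IsActive a t c m
    · have hm' := (isActive_fill_self ht hsep m e' c).2 hm
      rw [fill_apply_self, if_pos hm', fill_apply_self, if_pos hm, fill_apply_self, if_pos hm,
        add_assoc]
    · have hm' := mt (isActive_fill_self ht hsep m e' c).1 hm
      rw [fill_apply_self, if_neg hm', fill_apply_self, if_neg hm, fill_apply_self, if_neg hm]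
  · rw [fill_apply_of_ne hv, fill_apply_of_ne hv, fill_apply_of_ne hv]

/-- `fill` by one unit, as a permutation. -/
noncomputable def fillPerm (v : Γ.V) : Equiv.Perm (Fin k → ZMod N) where
  toFun := fill a t v 1
  invFun := fill a t v (-1)
  left_inv c := by rw [fill_fill ht hsep, add_neg_cancel, fill_zero]
  right_inv c := by rw [fill_fill ht hsep, neg_add_cancel, fill_zero]

theorem fillPerm_zpow (v : Γ.V) (n : ℤ) (c : Fin k → ZMod N) :
    (fillPerm ht hsep v ^ n) c = fill a t v n c := by
  induction n using Int.induction_on generalizing c with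
  | zero => simp [fill_zero]
  | succ i ih =>
    rw [zpow_add_one, Equiv.Perm.mul_apply, ih]
    refine (fill_fill ht hsep v _ _ c).trans ?_
    push_cast; rw [add_comm]
  | pred i ih =>
    rw [zpow_sub_one, Equiv.Perm.mul_apply, ih]
    refine (fill_fill ht hsep v _ _ c).trans ?_
    push_cast; rw [sub_eq_add_neg, add_comm]

/-- The action of `A Γ` on fillings. -/
noncomputable def fillHom : Raag Γ →* Equiv.Perm (Fin k → ZMod N) :=
  liftAny (fillPerm ht hsep) fun v w hvw => by
    by_cases hne : v = w
    · rw [hne]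
    · exact Equiv.ext fun c => fill_comm hne hvw 1 1 c

theorem fillHom_of_zpow (v : Γ.V) (n : ℤ) (c : Fin k → ZMod N) :
    fillHom ht hsep (of v ^ n) c = fill a t v n c := by
  rw [map_zpow, fillHom, liftAny_of, fillPerm_zpow]

end Filling

/-- Right-angled Artin groups are residually finite. -/
theorem exists_perm_ne_one {z : Raag Γ} (hz : z ≠ 1) :
    ∃ (X : Type) (_ : Fintype X) (ρ : Raag Γ →* Equiv.Perm X), ρ z ≠ 1 := by
  obtain ⟨L, hL, rfl⟩ := exists_isReduced z
  have hpos : 0 < L.length := by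
    rw [List.length_pos_iff]; rintro rfl; exact hz rfl
  -- This modulus exceeds every absolute exponent, so no exponent vanishes mod `N`.
  let N : ℕ := (L.map fun s => s.2.natAbs).sum + 1
  have : NeZero N := ⟨Nat.succ_ne_zero _⟩
  let a : Fin L.length → Γ.V := fun i => L[i].1
  let t : Fin L.length → ZMod N := fun i => (L[i].2 : ℤ)
  have ht : ∀ m, t m ≠ 0 := by
    intro m h
    have hmem : L[m] ∈ L := List.getElem_mem _
    rw [ZMod.intCast_zmod_eq_zero_iff_dvd] at h
    have h1 : L[m].2.natAbs ≤ (L.map fun s => s.2.natAbs).sum :=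
      List.single_le_sum (fun _ _ => Nat.zero_le _) _ (List.mem_map_of_mem hmem)
    have h2 := Nat.le_of_dvd (Int.natAbs_pos.2 (hL.ne_zero _ hmem)) (Int.natCast_dvd.1 h)
    omega
  have hsep : ∀ i j, i < j → a i = a j → ∃ m, i < m ∧ m < j ∧ ¬ Γ.Adj (a i) (a m) := hL.separated
  refine ⟨Fin L.length → ZMod N, inferInstance, fillHom ht hsep, fun h => ?_⟩
  -- In `S j` the syllables from position `j` on are full and the others empty. The word acts from
  -- its right end: syllable `j` is active in `S (j + 1)` and gets filled completely, so the empty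
  -- filling `S L.length` is moved to the full filling `S 0`.
  let S : ℕ → Fin L.length → ZMod N := fun j m => if j ≤ m then t m else 0
  have hS : ∀ j ≤ L.length, fillHom ht hsep (syllableProd (L.drop j)) (S L.length) = S j := by
    intro j hj
    induction hj using Nat.decreasingInduction with
    | self => simp [syllableProd]
    | of_succ j hj ih =>
      rw [List.drop_eq_getElem_cons hj, syllableProd_cons, map_mul, Equiv.Perm.mul_apply, ih,
        fillHom_of_zpow]
      have hact : IsActive a t (S (j + 1)) ⟨j, hj⟩ := by
        intro m hm _
        have hm' : (m : ℕ) ≠ j := fun h => hm (Fin.ext h)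
        simp only [S, Fin.lt_def]
        split_ifs <;> first | rfl | omega
      refine (fill_of_isActive ht hsep hact _).trans ?_
      funext m
      by_cases hm : m = ⟨j, hj⟩
      · subst hm
        simp [S, t]
      · have hm' : (m : ℕ) ≠ j := fun h => hm (Fin.ext h)
        rw [Function.update_of_ne hm]
        simp only [S]
        split_ifs <;> first | rfl | omega
  have h0 := hS 0 (Nat.zero_le _)
  rw [List.drop_zero, h, Equiv.Perm.one_apply] at h0
  have h1 := congrFun h0 ⟨0, hpos⟩
  simp only [S] at h1
  rw [if_neg (by simpa using hpos.ne'), if_pos (Nat.zero_le _)] at h1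
  exact ht _ h1.symm

end Raag

/-! ### The word problem for finitely presented residually finite groups -/

namespace GWord

theorem eval_append {α : Type} {G : Type u} [Group G] (x : α → G) (v w : GWord α) :
    eval x (v ++ w) = eval x v * eval x w := by
  rw [eval, ← FreeGroup.mul_mk, map_mul]; rfl

theorem eval_invRev {α : Type} {G : Type u} [Group G] (x : α → G) (w : GWord α) :
    eval x (FreeGroup.invRev w) = (eval x w)⁻¹ := by
  rw [eval, ← FreeGroup.inv_mk, map_inv]; rfl

theorem eval_rename {α β : Type} {G : Type u} [Group G] (e : α → β) (x : β → G) (w : GWord α) :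
    eval x (rename e w) = eval (x ∘ e) w := by
  simp [eval, rename, FreeGroup.lift_mk, Function.comp_def]

theorem eval_cons {α : Type} {G : Type u} [Group G] (x : α → G) (a : α × Bool) (w : GWord α) :
    eval x (a :: w) = (if a.2 then x a.1 else (x a.1)⁻¹) * eval x w := by
  rcases a with ⟨a, _ | _⟩ <;> simp [eval, FreeGroup.lift_mk]

theorem mk_rename {α β : Type} (e : α → β) (w : GWord α) :
    FreeGroup.mk (rename e w) = FreeGroup.map e (FreeGroup.mk w) := by
  simp [rename, FreeGroup.map.mk, Prod.map_def]

end GWord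

/-- The subgroup of relations that follow from the given relators. -/
def relSubgroup {α : Type} (rels : List (GWord α)) : Subgroup (FreeGroup α) :=
  Subgroup.normalClosure {r | ∃ w ∈ rels, r = FreeGroup.mk w}

instance {α : Type} (rels : List (GWord α)) : (relSubgroup rels).Normal :=
  Subgroup.normalClosure_normal

/-- A product of conjugates of relators and of their inverses, where the relators are given by
their position in the list. -/
def relProd (rels : List (GWord ℕ)) (L : List (GWord ℕ × ℕ × Bool)) : GWord ℕ :=
  L.flatMap fun p => p.1 ++
    (if p.2.2 then rels.getD p.2.1 [] else FreeGroup.invRev (rels.getD p.2.1 [])) ++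
    FreeGroup.invRev p.1

theorem mk_relProd_append (rels : List (GWord ℕ)) (L M : List (GWord ℕ × ℕ × Bool)) :
    FreeGroup.mk (relProd rels (L ++ M)) =
      FreeGroup.mk (relProd rels L) * FreeGroup.mk (relProd rels M) := by
  rw [FreeGroup.mul_mk]; simp [relProd]

theorem mk_relProd_singleton (rels : List (GWord ℕ)) (c : GWord ℕ) (j : ℕ) (b : Bool) :
    FreeGroup.mk (relProd rels [(c, j, b)]) = FreeGroup.mk c *
      (if b then FreeGroup.mk (rels.getD j []) else (FreeGroup.mk (rels.getD j []))⁻¹) *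
      (FreeGroup.mk c)⁻¹ := by
  cases b <;> simp [relProd, FreeGroup.inv_mk, FreeGroup.mul_mk]

theorem mk_relProd_mem (rels : List (GWord ℕ)) (L : List (GWord ℕ × ℕ × Bool)) :
    FreeGroup.mk (relProd rels L) ∈ relSubgroup rels := by
  induction L with
  | nil => exact one_mem _
  | cons p L ih =>
    obtain ⟨c, j, b⟩ := p
    rw [← List.singleton_append, mk_relProd_append, mk_relProd_singleton]
    refine mul_mem (Subgroup.Normal.conj_mem inferInstance _ ?_ _) ih
    -- A position past the end of the list denotes the empty word, so every list is a legitimate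
    -- certificate.
    have : FreeGroup.mk (rels.getD j []) ∈ relSubgroup rels := by
      by_cases hj : j < rels.length
      · rw [List.getD_eq_getElem _ _ hj]
        exact Subgroup.subset_normalClosure ⟨_, List.getElem_mem hj, rfl⟩
      · rw [List.getD_eq_default _ _ (not_lt.1 hj)]; exact one_mem _
    split_ifs
    · exact this
    · exact inv_mem this

theorem exists_relProd_eq {rels : List (GWord ℕ)} {g : FreeGroup ℕ} (hg : g ∈ relSubgroup rels) :
    ∃ L, FreeGroup.mk (relProd rels L) = g := by
  induction hg using Subgroup.closure_induction with
  | mem x hx =>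
    obtain ⟨_, ⟨r, hr, rfl⟩, hc⟩ := Group.mem_conjugatesOfSet_iff.1 hx
    obtain ⟨c, rfl⟩ := isConj_iff.1 hc
    obtain ⟨j, hj, rfl⟩ := List.mem_iff_getElem.1 hr
    refine ⟨[(c.toWord, j, true)], ?_⟩
    rw [mk_relProd_singleton, FreeGroup.mk_toWord, List.getD_eq_getElem _ _ hj, if_pos rfl]
  | one => exact ⟨[], rfl⟩
  | mul x y _ _ hx hy =>
    obtain ⟨L, rfl⟩ := hx
    obtain ⟨M, rfl⟩ := hy
    exact ⟨L ++ M, mk_relProd_append rels L M⟩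
  | inv x _ hx =>
    obtain ⟨L, rfl⟩ := hx
    clear * -
    induction L with
    | nil => exact ⟨[], rfl⟩
    | cons p L ih =>
      obtain ⟨M, hM⟩ := ih
      obtain ⟨c, j, b⟩ := p
      -- The inverse of a product reverses the factors and flips their signs.
      refine ⟨M ++ [(c, j, !b)], ?_⟩
      rw [mk_relProd_append, hM, mk_relProd_singleton, ← List.singleton_append (l := L),
        mk_relProd_append, mk_relProd_singleton]
      cases b <;> simp

/-! ### Finite permutation actions encoded by transpositions -/

/-- The action on `s` of the product of a list of transpositions. -/
def swapAct (l : List (ℕ × ℕ)) (s : ℕ) : ℕ :=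
  l.foldr (fun p s => if s = p.1 then p.2 else if s = p.2 then p.1 else s) s

/-- The action on `s` of a word, when the letter `i` stands for the product of the `i`-th list of
transpositions. -/
def wordAct (A : List (List (ℕ × ℕ))) (w : GWord ℕ) (s : ℕ) : ℕ :=
  w.foldr (fun a s => swapAct (if a.2 then A.getD a.1 [] else (A.getD a.1 []).reverse) s) s

/-- The numbers that occur in lists of transpositions. -/
def swapSupport (A : List (List (ℕ × ℕ))) : List ℕ := A.flatten.flatMap fun p => [p.1, p.2]

/-- The product of a list of transpositions. -/
def swapProd {α : Type} [DecidableEq α] (l : List (α × α)) : Equiv.Perm α :=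
  (l.map fun p => Equiv.swap p.1 p.2).prod

/-- The permutations given by lists of transpositions. -/
def permOf (A : List (List (ℕ × ℕ))) (i : ℕ) : Equiv.Perm ℕ := swapProd (A.getD i [])

theorem swapAct_eq (l : List (ℕ × ℕ)) (s : ℕ) : swapAct l s = swapProd l s := by
  induction l with
  | nil => rfl
  | cons p l ih =>
    rw [swapProd, List.map_cons, List.prod_cons, Equiv.Perm.mul_apply, Equiv.swap_apply_def]
    change (if swapAct l s = p.1 then p.2 else if swapAct l s = p.2 then p.1 else swapAct l s) = _
    rw [ih]; rfl

theorem swapProd_reverse {α : Type} [DecidableEq α] (l : List (α × α)) :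
    swapProd l.reverse = (swapProd l)⁻¹ := by
  rw [swapProd, swapProd, List.prod_inv_reverse, List.map_reverse, List.map_map]
  simp [Function.comp_def]

theorem wordAct_eq (A : List (List (ℕ × ℕ))) (w : GWord ℕ) (s : ℕ) :
    wordAct A w s = FreeGroup.lift (permOf A) (FreeGroup.mk w) s := by
  induction w with
  | nil => rfl
  | cons a w ih =>
    change swapAct _ (wordAct A w s) = GWord.eval (permOf A) (a :: w) s
    rw [GWord.eval_cons, ih, swapAct_eq]
    cases a.2 <;> simp [GWord.eval, permOf, swapProd_reverse]

theorem exists_swapProd_eq {k : ℕ} (σ : Equiv.Perm (Fin k)) : ∃ l, swapProd l = σ := by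
  induction σ using Equiv.Perm.swap_induction_on with
  | one => exact ⟨[], rfl⟩
  | swap_mul f x y _ ih =>
    obtain ⟨l, rfl⟩ := ih
    exact ⟨(x, y) :: l, rfl⟩

theorem swapProd_map_val {k : ℕ} (l : List (Fin k × Fin k)) (s : Fin k) :
    swapProd (l.map (Prod.map Fin.val Fin.val)) s = (swapProd l s : ℕ) := by
  induction l with
  | nil => rfl
  | cons p l ih =>
    change Equiv.swap _ _ (swapProd (l.map (Prod.map Fin.val Fin.val)) s) =
      ((Equiv.swap p.1 p.2 (swapProd l s) : Fin k) : ℕ)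
    rw [ih, Equiv.swap_apply_def, Equiv.swap_apply_def]
    simp only [Prod.map_fst, Prod.map_snd, Fin.val_inj]
    split_ifs <;> rfl

theorem swapProd_apply_of_notMem {l : List (ℕ × ℕ)} {s : ℕ}
    (h : ∀ p ∈ l, s ≠ p.1 ∧ s ≠ p.2) : swapProd l s = s := by
  induction l with
  | nil => rfl
  | cons p l ih =>
    change Equiv.swap _ _ (swapProd l s) = s
    rw [ih fun q hq => h q (List.mem_cons_of_mem _ hq)]
    exact Equiv.swap_apply_of_ne_of_ne (h p List.mem_cons_self).1 (h p List.mem_cons_self).2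

theorem lift_permOf_apply_of_notMem {A : List (List (ℕ × ℕ))} {s : ℕ} (h : s ∉ swapSupport A)
    (g : FreeGroup ℕ) : FreeGroup.lift (permOf A) g s = s := by
  have key : ∀ i, permOf A i s = s := by
    intro i
    refine swapProd_apply_of_notMem fun p hp => ?_
    by_contra hne
    refine h (List.mem_flatMap.2 ⟨p, List.mem_flatten.2 ⟨A.getD i [], ?_, hp⟩, by
      simp only [List.mem_cons, List.not_mem_nil, or_false]; tauto⟩)
    by_cases hi : i < A.length
    · rw [List.getD_eq_getElem _ _ hi]; exact List.getElem_mem hi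
    · rw [List.getD_eq_default _ _ (not_lt.1 hi)] at hp; simp at hp
  have : (FreeGroup.lift (permOf A)).range ≤ MulAction.stabilizer (Equiv.Perm ℕ) s := by
    refine FreeGroup.range_lift_le ?_
    rintro _ ⟨i, rfl⟩
    exact key i
  exact this ⟨g, rfl⟩

/-- `L` is a certificate for the triviality of `w`. -/
def IsTrivialCert (rels : List (GWord ℕ)) (w : GWord ℕ) (L : List (GWord ℕ × ℕ × Bool)) : Prop :=
  FreeGroup.reduce (relProd rels L) = FreeGroup.reduce w

/-- A finite permutation action and a point that certify the nontriviality of `w`. -/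
def IsNontrivialCert (rels : List (GWord ℕ)) (w : GWord ℕ) (A : List (List (ℕ × ℕ)) × ℕ) : Prop :=
  (∀ r ∈ rels, ∀ s ∈ swapSupport A.1, wordAct A.1 r s = s) ∧ wordAct A.1 w A.2 ≠ A.2

theorem exists_isTrivialCert_iff {rels : List (GWord ℕ)} {w : GWord ℕ} :
    (∃ L, IsTrivialCert rels w L) ↔ FreeGroup.mk w ∈ relSubgroup rels := by
  constructor
  · rintro ⟨L, hL⟩
    rw [← FreeGroup.reduce.exact hL]
    exact mk_relProd_mem rels L
  · intro h
    obtain ⟨L, hL⟩ := exists_relProd_eq h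
    exact ⟨L, FreeGroup.reduce.sound hL⟩

/-- Points outside the support are fixed by every word, so the finite check on the support shows
that all relators act trivially on `ℕ`; the action then factors through the quotient, where `w`
moves a point. -/
theorem IsNontrivialCert.notMem {rels : List (GWord ℕ)} {w : GWord ℕ}
    {A : List (List (ℕ × ℕ)) × ℕ} (h : IsNontrivialCert rels w A) :
    FreeGroup.mk w ∉ relSubgroup rels := by
  intro hw
  have : relSubgroup rels ≤ (FreeGroup.lift (permOf A.1)).ker := by
    refine Subgroup.normalClosure_le_normal ?_
    rintro _ ⟨r, hr, rfl⟩
    refine Equiv.ext fun s => ?_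
    by_cases hs : s ∈ swapSupport A.1
    · rw [← wordAct_eq]; exact h.1 r hr s hs
    · exact lift_permOf_apply_of_notMem hs _
  refine h.2 ?_
  rw [wordAct_eq, MonoidHom.mem_ker.1 (this hw)]; rfl

/-- Each permutation is factored into transpositions. The list of factorizations has length `n`, so
later letters act as the identity; `hσ` ensures that this agrees with `σ`. -/
theorem exists_isNontrivialCert {rels : List (GWord ℕ)} {w : GWord ℕ} {k n : ℕ}
    (σ : ℕ → Equiv.Perm (Fin k)) (hσ : ∀ i, n ≤ i → σ i = 1)
    (hrels : ∀ r ∈ rels, FreeGroup.lift σ (FreeGroup.mk r) = 1)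
    (hw : FreeGroup.lift σ (FreeGroup.mk w) ≠ 1) : ∃ A, IsNontrivialCert rels w A := by
  choose l hl using fun i => exists_swapProd_eq (σ i)
  let A : List (List (ℕ × ℕ)) :=
    List.ofFn fun i : Fin n => (l i).map (Prod.map Fin.val Fin.val)
  have key : ∀ i (s : Fin k), permOf A i s = (σ i s : ℕ) := by
    intro i s
    by_cases hi : i < n
    · rw [permOf, List.getD_eq_getElem _ _ (by simpa [A] using hi), List.getElem_ofFn,
        swapProd_map_val, hl]
    · rw [permOf, List.getD_eq_default _ _ (by simpa [A] using hi), hσ i (not_lt.1 hi)]; rfl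
  have key' : ∀ (g : FreeGroup ℕ) (s : Fin k),
      FreeGroup.lift (permOf A) g s = (FreeGroup.lift σ g s : ℕ) := by
    intro g
    induction g using FreeGroup.induction_on with
    | C1 => intro s; rfl
    | of i => intro s; simpa using key i s
    | inv_of i _ =>
      intro s
      simp only [map_inv, FreeGroup.lift_apply_of]
      rw [Equiv.Perm.inv_eq_iff_eq, key]; simp
    | mul g h hg hh => intro s; simp [hg, hh]
  have hsupp : ∀ s ∈ swapSupport A, s < k := by
    intro s hs
    obtain ⟨p, hp, hs⟩ := List.mem_flatMap.1 hs
    obtain ⟨q, hq, hp⟩ := List.mem_flatten.1 hp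
    obtain ⟨i, rfl⟩ := (List.mem_ofFn' _ _).1 hq
    obtain ⟨⟨a, b⟩, -, rfl⟩ := List.mem_map.1 hp
    simp only [Prod.map_apply, List.mem_cons, List.not_mem_nil, or_false] at hs
    rcases hs with rfl | rfl
    exacts [a.2, b.2]
  obtain ⟨s, hs⟩ : ∃ s, FreeGroup.lift σ (FreeGroup.mk w) s ≠ s := by
    by_contra! h
    exact hw (Equiv.ext h)
  refine ⟨(A, s), fun r hr s' hs' => ?_, ?_⟩
  · have := key' (FreeGroup.mk r) ⟨s', hsupp s' hs'⟩
    rw [hrels r hr] at this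
    rw [wordAct_eq]; exact this
  · change wordAct A w s ≠ s
    rw [wordAct_eq, key']
    exact fun h => hs (Fin.ext h)

/-! ### Computability of the certificates -/

section Primrec

open Primrec

theorem primrec_invRev : Primrec (FreeGroup.invRev : GWord ℕ → GWord ℕ) :=
  list_reverse.comp (list_map .id
    (Primrec.pair (fst.comp snd) (Primrec.not.comp (snd.comp snd))).to₂)

/-- Free reduction is a right fold: each letter cancels against the head of the reduced tail or is
put in front of it. -/
theorem primrec_reduce : Primrec (FreeGroup.reduce : GWord ℕ → GWord ℕ) := by
  have hc : PrimrecPred fun q : (GWord ℕ × (ℕ × Bool) × GWord ℕ) × (ℕ × Bool) × GWord ℕ =>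
      q.1.2.1.1 = q.2.1.1 ∧ q.1.2.1.2 = !q.2.1.2 :=
    (Primrec.eq.comp (fst.comp (fst.comp (snd.comp fst))) (fst.comp (fst.comp snd))).and
      (Primrec.eq.comp (snd.comp (fst.comp (snd.comp fst)))
        (Primrec.not.comp (snd.comp (fst.comp snd))))
  have h : Primrec₂ fun (_ : GWord ℕ) (p : (ℕ × Bool) × GWord ℕ) =>
      (List.casesOn p.2 [p.1] fun hd tl =>
        if p.1.1 = hd.1 ∧ p.1.2 = !hd.2 then tl else p.1 :: hd :: tl : GWord ℕ) :=
    list_casesOn (snd.comp snd) (list_cons.comp (fst.comp snd) (.const []))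
      (Primrec.ite hc (snd.comp snd) (list_cons.comp (fst.comp (snd.comp fst))
        (list_cons.comp (fst.comp snd) (snd.comp snd)))).to₂
  refine (list_foldr .id (.const []) h).of_eq fun w => ?_
  induction w with
  | nil => rfl
  | cons a w ih => rw [FreeGroup.reduce.cons, ← ih]; rfl

theorem primrec_relProd : Primrec₂ relProd := by
  have hr : Primrec₂ fun (q : List (GWord ℕ) × List (GWord ℕ × ℕ × Bool))
      (p : GWord ℕ × ℕ × Bool) => q.1.getD p.2.1 [] :=
    (list_getD []).comp (fst.comp fst) (fst.comp (snd.comp snd))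
  refine list_flatMap snd (list_append.comp (list_append.comp (fst.comp snd)
    (Primrec.ite (Primrec.eq.comp (snd.comp (snd.comp snd)) (.const true)) hr
      (primrec_invRev.comp hr))) (primrec_invRev.comp (fst.comp snd))).to₂

theorem primrec_swapAct : Primrec₂ swapAct :=
  list_foldr fst snd (Primrec.ite (Primrec.eq.comp (snd.comp snd) (fst.comp (fst.comp snd)))
    (snd.comp (fst.comp snd))
    (Primrec.ite (Primrec.eq.comp (snd.comp snd) (snd.comp (fst.comp snd)))
      (fst.comp (fst.comp snd)) (snd.comp snd))).to₂

theorem primrec_wordAct :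
    Primrec fun q : (List (List (ℕ × ℕ)) × GWord ℕ) × ℕ => wordAct q.1.1 q.1.2 q.2 := by
  have hr : Primrec fun q : ((List (List (ℕ × ℕ)) × GWord ℕ) × ℕ) × (ℕ × Bool) × ℕ =>
      q.1.1.1.getD q.2.1.1 [] :=
    (list_getD []).comp (fst.comp (fst.comp fst)) (fst.comp (fst.comp snd))
  exact list_foldr (snd.comp fst) snd (primrec_swapAct.comp
    (Primrec.ite (Primrec.eq.comp (snd.comp (fst.comp snd)) (.const true)) hr
      (list_reverse.comp hr)) (snd.comp snd)).to₂

theorem primrec_swapSupport : Primrec swapSupport :=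
  list_flatMap list_flatten (list_cons.comp (fst.comp snd)
    (list_cons.comp (snd.comp snd) (.const []))).to₂

theorem primrecPred_isTrivialCert :
    PrimrecPred fun q : (List (GWord ℕ) × GWord ℕ) × List (GWord ℕ × ℕ × Bool) =>
      IsTrivialCert q.1.1 q.1.2 q.2 :=
  Primrec.eq.comp (primrec_reduce.comp (primrec_relProd.comp (fst.comp fst) snd))
    (primrec_reduce.comp (snd.comp fst))

theorem primrecPred_isNontrivialCert :
    PrimrecPred fun q : (List (GWord ℕ) × GWord ℕ) × List (List (ℕ × ℕ)) × ℕ =>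
      IsNontrivialCert q.1.1 q.1.2 q.2 := by
  have h1 : PrimrecRel fun (s : ℕ) (p : List (List (ℕ × ℕ)) × GWord ℕ) => wordAct p.1 p.2 s = s :=
    Primrec.eq.comp (primrec_wordAct.comp (Primrec.pair snd fst)) fst
  have h2 : PrimrecRel fun (r : GWord ℕ) (A : List (List (ℕ × ℕ))) =>
      ∀ s ∈ swapSupport A, wordAct A r s = s :=
    h1.forall_mem_list.comp (primrec_swapSupport.comp snd) (Primrec.pair snd fst)
  refine (h2.forall_mem_list.comp (fst.comp fst) (fst.comp snd)).and (Primrec.eq.comp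
    (primrec_wordAct.comp (Primrec.pair (Primrec.pair (fst.comp snd) (snd.comp fst))
      (snd.comp snd))) (snd.comp snd)).not

end Primrec

open Classical in
/-- Look for certificates of the triviality or of the nontriviality of a word. -/
noncomputable def wordProblem (q : List (GWord ℕ) × GWord ℕ) : Part Bool :=
  Nat.rfindOpt fun n =>
    (Encodable.decode (α := List (GWord ℕ × ℕ × Bool) × List (List (ℕ × ℕ)) × ℕ) n).bind fun k =>
      if IsTrivialCert q.1 q.2 k.1 then some true
      else if IsNontrivialCert q.1 q.2 k.2 then some false else none

theorem partrec_wordProblem : Partrec wordProblem := by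
  classical
  open Primrec in
  refine Partrec.rfindOpt (Primrec.to_comp ?_)
  exact option_bind (Primrec.decode.comp snd) (Primrec.ite
    (primrecPred_isTrivialCert.comp (Primrec.pair (fst.comp fst) (fst.comp snd)))
    (.const (some true))
    (Primrec.ite (primrecPred_isNontrivialCert.comp (Primrec.pair (fst.comp fst) (snd.comp snd)))
      (.const (some false)) (.const none))).to₂

-- Any answer found is right since both kinds of certificates are sound. The hypothesis is needed
-- only so that the search stops on nontrivial words.
open Classical in
theorem wordProblem_eq {rels : List (GWord ℕ)} {w : GWord ℕ}
    (h : FreeGroup.mk w ∉ relSubgroup rels → ∃ A, IsNontrivialCert rels w A) :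
    wordProblem (rels, w) = Part.some (decide (FreeGroup.mk w ∈ relSubgroup rels)) := by
  have hsound : ∀ b ∈ wordProblem (rels, w), b = decide (FreeGroup.mk w ∈ relSubgroup rels) := by
    intro b hb
    obtain ⟨n, hn⟩ := Nat.rfindOpt_spec hb
    obtain ⟨k, -, hk⟩ := Option.mem_bind_iff.1 hn
    split_ifs at hk with h1 h2
    · rw [Option.mem_some_iff] at hk
      rw [← hk, decide_eq_true (exists_isTrivialCert_iff.1 ⟨_, h1⟩)]
    · rw [Option.mem_some_iff] at hk
      rw [← hk, decide_eq_false h2.notMem]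
    · simp at hk
  have hdom : (wordProblem (rels, w)).Dom := by
    rw [wordProblem, Nat.rfindOpt_dom]
    by_cases hw : FreeGroup.mk w ∈ relSubgroup rels
    · obtain ⟨L, hL⟩ := exists_isTrivialCert_iff.2 hw
      -- The search runs over pairs of certificates; the half that plays no role is a dummy.
      refine ⟨Encodable.encode (L, ([] : List (List (ℕ × ℕ))), 0), true, ?_⟩
      rw [Encodable.encodek, Option.bind_some, if_pos hL]; rfl
    · obtain ⟨A, hA⟩ := h hw
      refine ⟨Encodable.encode (([] : List (GWord ℕ × ℕ × Bool)), A), false, ?_⟩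
      rw [Encodable.encodek, Option.bind_some,
        if_neg fun h' => hw (exists_isTrivialCert_iff.1 ⟨_, h'⟩), if_pos hA]; rfl
  rw [← hsound _ (Part.get_mem hdom)]
  exact (Part.some_get hdom).symm

/-! ### The word problem for a presentation on finitely many letters -/

/-- Extend a finite family of group elements by `1`. -/
def extendByOne {n : ℕ} {G : Type u} [Group G] (x : Fin n → G) (i : ℕ) : G :=
  if h : i < n then x ⟨i, h⟩ else 1

theorem extendByOne_comp_val {n : ℕ} {G : Type u} [Group G] (x : Fin n → G) :
    extendByOne x ∘ Fin.val = x :=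
  funext fun i => dif_pos i.2

theorem extendByOne_of_le {n : ℕ} {G : Type u} [Group G] (x : Fin n → G) {i : ℕ} (h : n ≤ i) :
    extendByOne x i = 1 :=
  dif_neg (not_lt.2 h)

theorem eval_extendByOne_rename {n : ℕ} {G : Type u} [Group G] (x : Fin n → G)
    (w : GWord (Fin n)) : GWord.eval (extendByOne x) (GWord.rename Fin.val w) = GWord.eval x w := by
  rw [GWord.eval_rename, extendByOne_comp_val]

theorem eval_extendByOne_filter {n : ℕ} {G : Type u} [Group G] (x : Fin n → G) (w : GWord ℕ) :
    GWord.eval (extendByOne x) (w.filter fun a => a.1 < n) = GWord.eval (extendByOne x) w := by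
  induction w with
  | nil => rfl
  | cons a w ih =>
    by_cases h : a.1 < n
    · rw [List.filter_cons_of_pos (by simpa using h), GWord.eval_cons, GWord.eval_cons, ih]
    · rw [List.filter_cons_of_neg (by simpa using h), GWord.eval_cons, ih,
        extendByOne_of_le x (not_lt.1 h)]
      simp

theorem exists_rename_eq_filter (n : ℕ) (w : GWord ℕ) :
    ∃ v : GWord (Fin n), GWord.rename Fin.val v = w.filter fun a => a.1 < n := by
  induction w with
  | nil => exact ⟨[], rfl⟩
  | cons a w ih =>
    obtain ⟨v, hv⟩ := ih
    by_cases h : a.1 < n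
    · refine ⟨(⟨a.1, h⟩, a.2) :: v, ?_⟩
      rw [List.filter_cons_of_pos (by simpa using h), ← hv]; rfl
    · refine ⟨v, ?_⟩
      rw [List.filter_cons_of_neg (by simpa using h), hv]

/-- Letters from `n` on evaluate to `1` but are subject to no relator in the free group on `ℕ`, so
they must be deleted before membership is tested. -/
theorem mk_filter_mem_relSubgroup_iff {n : ℕ} {G : Type u} [Group G] {x : Fin n → G}
    {rels : List (GWord (Fin n))} (hx : Presents x rels) (w : GWord ℕ) :
    FreeGroup.mk (w.filter fun a => a.1 < n) ∈ relSubgroup (rels.map (GWord.rename Fin.val)) ↔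
      GWord.eval (extendByOne x) w = 1 := by
  obtain ⟨v, hv⟩ := exists_rename_eq_filter n w
  rw [← eval_extendByOne_filter, ← hv]
  have hmem : ∀ v : GWord (Fin n), GWord.eval x v = 1 ↔ FreeGroup.mk v ∈ relSubgroup rels := by
    intro v
    rw [relSubgroup, ← hx.2]; rfl
  constructor
  · intro h
    have : relSubgroup (rels.map (GWord.rename Fin.val)) ≤
        (FreeGroup.lift (extendByOne x)).ker := by
      refine Subgroup.normalClosure_le_normal ?_
      rintro _ ⟨r, hr, rfl⟩
      obtain ⟨r, hr', rfl⟩ := List.mem_map.1 hr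
      refine (eval_extendByOne_rename x r).trans ((hmem r).2 ?_)
      exact Subgroup.subset_normalClosure ⟨r, hr', rfl⟩
    exact this h
  · intro h
    rw [eval_extendByOne_rename, hmem] at h
    have : relSubgroup rels ≤
        (relSubgroup (rels.map (GWord.rename Fin.val))).comap (FreeGroup.map Fin.val) := by
      refine Subgroup.normalClosure_le_normal ?_
      rintro _ ⟨r, hr, rfl⟩
      refine Subgroup.subset_normalClosure ⟨_, List.mem_map_of_mem hr, ?_⟩
      rw [GWord.mk_rename]
    rw [GWord.mk_rename]
    exact this h

/-- Residual finiteness: every nontrivial element acts nontrivially on some finite set on which the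
group acts. -/
def IsResiduallyFinite (G : Type u) [Group G] : Prop :=
  ∀ g : G, g ≠ 1 → ∃ (X : Type) (_ : Fintype X) (ρ : G →* Equiv.Perm X), ρ g ≠ 1

theorem ACCoalgebra.isResiduallyFinite (G : ACCoalgebra.{u}) : IsResiduallyFinite G.A := by
  intro g hg
  obtain ⟨p⟩ := G.nonempty_graphPresentation
  have : p.inv g ≠ 1 := fun h => hg (by rw [← p.hom_inv g, h, map_one])
  obtain ⟨X, hX, ρ, hρ⟩ := Raag.exists_perm_ne_one this
  exact ⟨X, hX, ρ.comp p.inv, hρ⟩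

/-- Decide whether a word represents the neutral element, where letters without a meaning are
dropped. -/
noncomputable def isOneTest (q : (ℕ × List (GWord ℕ)) × GWord ℕ) : Part Bool :=
  wordProblem (q.1.2, q.2.filter fun a => a.1 < q.1.1)

theorem partrec_isOneTest : Partrec isOneTest := by
  open Primrec in
  have hR : PrimrecRel fun (a : ℕ × Bool) (n : ℕ) => a.1 < n :=
    Primrec.nat_lt.comp (fst.comp fst) snd
  refine partrec_wordProblem.comp (Primrec.to_comp (Primrec.pair (snd.comp fst) ?_))
  exact hR.listFilter.comp snd (fst.comp fst)

open Classical in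
theorem isOneTest_eq {n : ℕ} {G : Type u} [Group G] (hG : IsResiduallyFinite G) {x : Fin n → G}
    {rels : List (GWord (Fin n))} (hx : Presents x rels) (w : GWord ℕ) :
    isOneTest ((n, rels.map (GWord.rename Fin.val)), w) =
      Part.some (decide (GWord.eval (extendByOne x) w = 1)) := by
  rw [isOneTest, wordProblem_eq]
  · simp only [mk_filter_mem_relSubgroup_iff hx w]
  · intro hw
    rw [mk_filter_mem_relSubgroup_iff hx] at hw
    obtain ⟨X, _, ρ, hρ⟩ := hG _ hw
    -- Number the points of `X`, so that the action can be written down as a certificate.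
    let ρ' : G →* Equiv.Perm (Fin (Fintype.card X)) :=
      (Fintype.equivFin X).permCongrHom.toMonoidHom.comp ρ
    have hlift : ∀ v : GWord ℕ, FreeGroup.lift (ρ' ∘ extendByOne x) (FreeGroup.mk v) =
        ρ' (GWord.eval (extendByOne x) v) := fun v =>
      DFunLike.congr_fun (FreeGroup.ext_hom (f := FreeGroup.lift (ρ' ∘ extendByOne x))
        (g := ρ'.comp (FreeGroup.lift (extendByOne x))) (by simp)) (FreeGroup.mk v)
    refine exists_isNontrivialCert (n := n) (ρ' ∘ extendByOne x) (fun i hi => ?_)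
      (fun r hr => ?_) ?_
    · rw [Function.comp_apply, extendByOne_of_le x hi, map_one]
    · obtain ⟨r, hr', rfl⟩ := List.mem_map.1 hr
      have : FreeGroup.mk r ∈ (FreeGroup.lift x).ker := by
        rw [hx.2]; exact Subgroup.subset_normalClosure ⟨r, hr', rfl⟩
      rw [hlift, eval_extendByOne_rename, GWord.eval, MonoidHom.mem_ker.1 this, map_one]
    · rw [hlift, eval_extendByOne_filter]
      exact fun h => hρ ((Fintype.equivFin X).permCongrHom.injective (h.trans (map_one _).symm))

/-! ### Folds with partial recursive steps -/

/-- The fold is a recursion on the number of entries consumed: after `n` steps the state is the fold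
over the first `n` entries, and a step past the end changes nothing. -/
theorem Partrec.list_foldlM {α β σ : Type} [Primcodable α] [Primcodable β] [Primcodable σ]
    {f : α → List β} {g : α → σ} {h : α → σ × β →. σ} (hf : Computable f) (hg : Computable g)
    (hh : Partrec₂ h) :
    Partrec fun a => (f a).foldlM (fun s b => h a (s, b)) (g a) := by
  have hstep : Partrec₂ fun (a : α) (p : ℕ × σ) =>
      (((f a)[p.1]?).casesOn (Part.some p.2) fun b => h a (p.2, b) : Part σ) :=
    Partrec.optionCasesOn_right
      (Computable.list_getElem?.comp (hf.comp .fst) (Computable.fst.comp .snd))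
      (Computable.snd.comp .snd)
      (hh.comp (Computable.fst.comp .fst)
        (Computable.pair (Computable.snd.comp (Computable.snd.comp .fst)) .snd)).to₂
  refine (Partrec.nat_rec (Computable.list_length.comp hf) hg.partrec hstep).of_eq fun a => ?_
  have key : ∀ n : ℕ, (Nat.rec (Part.some (g a)) (fun y IH => IH.bind fun i =>
      (((f a)[y]?).casesOn (Part.some i) fun b => h a (i, b) : Part σ)) n : Part σ) =
      ((f a).take n).foldlM (fun s b => h a (s, b)) (g a) := by
    intro n
    induction n with
    | zero => rfl
    | succ n ih =>
      rw [List.take_add_one, List.foldlM_append, ← ih]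
      change Part.bind _ _ = Part.bind _ _
      congr 1
      funext s
      cases (f a)[n]? with
      | none => rfl
      | some b => simp
  rw [← List.take_length (l := f a), ← key]
  simp

theorem List.foldlM_eq_some {β σ : Type} {l : List β} {h : σ → β → Part σ} {h' : σ → β → σ}
    (hl : ∀ s, ∀ b ∈ l, h s b = Part.some (h' s b)) (s : σ) :
    l.foldlM h s = Part.some (l.foldl h' s) := by
  induction l generalizing s with
  | nil => rfl
  | cons b l ih =>
    rw [List.foldlM_cons, hl s b List.mem_cons_self, List.foldl_cons]
    exact (Part.bind_some _ _).trans (ih (fun s b hb => hl s b (List.mem_cons_of_mem _ hb)) _)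

/-! ### The algorithm -/

/-- Count one occurrence of a letter or of its inverse. -/
def countLetter (c : ℕ × ℕ) (e : Bool) : ℕ × ℕ :=
  if e then (c.1 + 1, c.2) else (c.1, c.2 + 1)

/-- Count how often the letters `[w]` and `[w]⁻¹`, where `w` represents the same element as the
given word, occur in an element of `AC G`. -/
noncomputable def letterCount (q : ((ℕ × List (GWord ℕ)) × GWord ℕ) × ACWord ℕ) : Part (ℕ × ℕ) :=
  q.2.foldlM (fun c a => (isOneTest (q.1.1, a.1 ++ FreeGroup.invRev q.1.2)).map fun b =>
    if b then countLetter c a.2 else c) (0, 0)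

/-- Decide whether a word represents a group-like element. -/
noncomputable def groupLikeTest (q : (ℕ × List (GWord ℕ) × List (ACWord ℕ)) × GWord ℕ) :
    Part Bool :=
  q.1.2.2.foldlM (fun b W => (letterCount (((q.1.1, q.1.2.1), q.2), W)).map fun c =>
    b || !decide (c.1 = c.2)) false

/-- Substitute words for the letters of a word. -/
def GWord.subst (L : List (GWord ℕ)) (w : GWord ℕ) : GWord ℕ :=
  w.flatMap fun a => if a.2 then L.getD a.1 [] else FreeGroup.invRev (L.getD a.1 [])

/-- Decide whether a homomorphism maps group-like elements to group-like elements. -/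
noncomputable def raagMapTest (c : InputCode) : Part Bool :=
  c.1.2.2.flatten.foldlM (fun b a => (groupLikeTest (c.1, a.1)).bind fun p =>
    (groupLikeTest (c.2.1, GWord.subst c.2.2 a.1)).map fun q => b && (!p || q)) true

section Computability

open Primrec

theorem primrec_countLetter : Primrec₂ countLetter :=
  Primrec.ite (Primrec.eq.comp snd (.const true))
    (Primrec.pair (Primrec.succ.comp (fst.comp fst)) (snd.comp fst))
    (Primrec.pair (fst.comp fst) (Primrec.succ.comp (snd.comp fst)))

theorem primrec_subst : Primrec₂ GWord.subst := by
  have hr : Primrec₂ fun (q : List (GWord ℕ) × GWord ℕ) (a : ℕ × Bool) => q.1.getD a.1 [] :=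
    (list_getD []).comp (fst.comp fst) (fst.comp snd)
  exact list_flatMap snd (Primrec.ite (Primrec.eq.comp (snd.comp snd) (.const true)) hr
    (primrec_invRev.comp hr)).to₂

theorem partrec_letterCount : Partrec letterCount := by
  have h1 : Primrec fun z : (((ℕ × List (GWord ℕ)) × GWord ℕ) × ACWord ℕ) × (ℕ × ℕ) ×
      GWord ℕ × Bool => (z.1.1.1, z.2.2.1 ++ FreeGroup.invRev z.1.1.2) :=
    Primrec.pair (fst.comp (fst.comp fst)) (list_append.comp (fst.comp (snd.comp snd))
      (primrec_invRev.comp (snd.comp (fst.comp fst))))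
  have h2 : Primrec₂ fun (z : (((ℕ × List (GWord ℕ)) × GWord ℕ) × ACWord ℕ) × (ℕ × ℕ) ×
      GWord ℕ × Bool) (b : Bool) => if b then countLetter z.2.1 z.2.2.2 else z.2.1 :=
    Primrec.ite (Primrec.eq.comp snd (.const true))
      (primrec_countLetter.comp (fst.comp (snd.comp fst)) (snd.comp (snd.comp (snd.comp fst))))
      (fst.comp (snd.comp fst))
  have h3 : Partrec₂ fun (q : ((ℕ × List (GWord ℕ)) × GWord ℕ) × ACWord ℕ)
      (p : (ℕ × ℕ) × GWord ℕ × Bool) =>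
      (isOneTest (q.1.1, p.2.1 ++ FreeGroup.invRev q.1.2)).map fun b =>
        if b then countLetter p.1 p.2.2 else p.1 :=
    Partrec.map (partrec_isOneTest.comp h1.to_comp) h2.to_comp
  have key := Partrec.list_foldlM (f := fun q : ((ℕ × List (GWord ℕ)) × GWord ℕ) × ACWord ℕ => q.2)
    (g := fun _ => ((0, 0) : ℕ × ℕ)) Computable.snd (.const _) h3
  exact key

theorem partrec_groupLikeTest : Partrec groupLikeTest := by
  have h1 : Primrec fun z : ((ℕ × List (GWord ℕ) × List (ACWord ℕ)) × GWord ℕ) × Bool × ACWord ℕ =>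
      (((z.1.1.1, z.1.1.2.1), z.1.2), z.2.2) :=
    Primrec.pair (Primrec.pair (Primrec.pair (fst.comp (fst.comp fst))
      (fst.comp (snd.comp (fst.comp fst)))) (snd.comp fst)) (snd.comp snd)
  have h2 : Primrec₂ fun (z : ((ℕ × List (GWord ℕ) × List (ACWord ℕ)) × GWord ℕ) × Bool × ACWord ℕ)
      (c : ℕ × ℕ) => z.2.1 || !decide (c.1 = c.2) :=
    Primrec.or.comp (fst.comp (snd.comp fst)) (Primrec.not.comp
      (PrimrecPred.decide (Primrec.eq.comp (fst.comp snd) (snd.comp snd))))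
  have h3 : Partrec₂ fun (q : (ℕ × List (GWord ℕ) × List (ACWord ℕ)) × GWord ℕ)
      (p : Bool × ACWord ℕ) => (letterCount (((q.1.1, q.1.2.1), q.2), p.2)).map fun c =>
        p.1 || !decide (c.1 = c.2) :=
    Partrec.map (partrec_letterCount.comp h1.to_comp) h2.to_comp
  have key := Partrec.list_foldlM
    (f := fun q : (ℕ × List (GWord ℕ) × List (ACWord ℕ)) × GWord ℕ => q.1.2.2)
    (g := fun _ => false) (snd.comp (snd.comp fst)).to_comp (.const _) h3
  exact key

theorem partrec_raagMapTest : Partrec raagMapTest := by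
  have h0 : Primrec fun c : InputCode => c.1.2.2.flatten :=
    list_flatten.comp (snd.comp (snd.comp fst))
  have h1 : Primrec fun z : InputCode × Bool × GWord ℕ × Bool => (z.1.1, z.2.2.1) :=
    Primrec.pair (fst.comp fst) (fst.comp (snd.comp snd))
  have h2 : Primrec fun z : (InputCode × Bool × GWord ℕ × Bool) × Bool =>
      (z.1.1.2.1, GWord.subst z.1.1.2.2 z.1.2.2.1) :=
    Primrec.pair (fst.comp (snd.comp (fst.comp fst)))
      (primrec_subst.comp (snd.comp (snd.comp (fst.comp fst)))
        (fst.comp (snd.comp (snd.comp fst))))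
  have h3 : Primrec₂ fun (z : (InputCode × Bool × GWord ℕ × Bool) × Bool) (b : Bool) =>
      z.1.2.1 && (!z.2 || b) :=
    Primrec.and.comp (fst.comp (snd.comp (fst.comp fst)))
      (Primrec.or.comp (Primrec.not.comp (snd.comp fst)) snd)
  have h4 : Partrec₂ fun (z : InputCode × Bool × GWord ℕ × Bool) (b : Bool) =>
      (groupLikeTest (z.1.2.1, GWord.subst z.1.2.2 z.2.2.1)).map fun b' => z.2.1 && (!b || b') :=
    Partrec.map (partrec_groupLikeTest.comp h2.to_comp) h3.to_comp
  have h5 : Partrec₂ fun (c : InputCode) (p : Bool × GWord ℕ × Bool) =>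
      (groupLikeTest (c.1, p.2.1)).bind fun b =>
        (groupLikeTest (c.2.1, GWord.subst c.2.2 p.2.1)).map fun b' => p.1 && (!b || b') :=
    Partrec.bind (partrec_groupLikeTest.comp h1.to_comp) h4
  have key := Partrec.list_foldlM (g := fun _ => true) h0.to_comp (.const _) h5
  exact key

end Computability

/-! ### Correctness -/

/-- The element of `AC G` described by a word in words. -/
def acEval {α : Type} {G : Type u} [Group G] (x : α → G) (W : ACWord α) :
    Raag (commutationGraph G) :=
  GWord.eval (fun w => Raag.of (Γ := commutationGraph G) (GWord.eval x w)) W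

theorem acEval_extendByOne_rename {n : ℕ} {G : Type u} [Group G] (x : Fin n → G)
    (W : ACWord (Fin n)) :
    acEval (extendByOne x) (GWord.rename (GWord.rename Fin.val) W) = acEval x W := by
  rw [acEval, GWord.eval_rename]
  refine congrArg (fun y => GWord.eval y W) (funext fun w => ?_)
  rw [Function.comp_apply, eval_extendByOne_rename]

-- The difference of the two counters is the exponent sum of `[g]`. The initial counters are
-- arbitrary so that the induction along the fold goes through.
open Classical in
theorem ofAdd_letterCount {α : Type} {G : Type u} [Group G] (x : α → G) (g : G) (W : ACWord α)
    (c : ℕ × ℕ) :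
    let d := W.foldl (fun c a => if GWord.eval x a.1 = g then countLetter c a.2 else c) c
    Multiplicative.ofAdd ((d.1 : ℤ) - d.2) = Multiplicative.ofAdd ((c.1 : ℤ) - c.2) *
      Raag.expSum (Γ := commutationGraph G) g (acEval x W) := by
  induction W generalizing c with
  | nil =>
    rw [acEval, show GWord.eval (fun w => Raag.of (Γ := commutationGraph G) (GWord.eval x w)) [] = 1
      from map_one _, map_one, mul_one]
    rfl
  | cons a W ih =>
    intro d
    have hd := ih (if GWord.eval x a.1 = g then countLetter c a.2 else c)
    refine Eq.trans hd ?_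
    rw [acEval, acEval, GWord.eval_cons, map_mul, ← mul_assoc]
    congr 1
    by_cases h : GWord.eval x a.1 = g
    · rw [if_pos h]
      rcases a with ⟨w, _ | _⟩
      · rw [if_neg Bool.false_ne_true, map_inv, Raag.expSum_of, if_pos h, ← ofAdd_neg,
          ← ofAdd_add]
        simp only [countLetter, Bool.false_eq_true, if_false]
        push_cast; ring_nf
      · rw [if_pos rfl, Raag.expSum_of, if_pos h, ← ofAdd_add]
        simp only [countLetter, if_true]
        push_cast; ring_nf
    · rw [if_neg h]
      split_ifs
      · rw [Raag.expSum_of, if_neg h, mul_one]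
      · rw [map_inv, Raag.expSum_of, if_neg h, inv_one, mul_one]

/-- This bounds the search for group-like elements: only letters occurring in the given words can be
group-like. -/
theorem exists_letter_of_expSum_ne_one {α : Type} {G : Type u} [Group G] {x : α → G} {g : G}
    {W : ACWord α} (h : Raag.expSum (Γ := commutationGraph G) g (acEval x W) ≠ 1) :
    ∃ a ∈ W, GWord.eval x a.1 = g := by
  classical
  by_contra! hne
  refine h ?_
  have h1 := ofAdd_letterCount x g W (0, 0)
  have h2 : W.foldl (fun c a => if GWord.eval x a.1 = g then countLetter c a.2 else c) (0, 0) =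
      (0, 0) := by
    clear h h1
    induction W with
    | nil => rfl
    | cons a W ih =>
      rw [List.foldl_cons, if_neg (hne a List.mem_cons_self)]
      exact ih fun b hb => hne b (List.mem_cons_of_mem _ hb)
  simp only [h2] at h1
  simpa using h1.symm

open Classical in
theorem exists_letterCount_eq {n : ℕ} {G : Type u} [Group G] (hG : IsResiduallyFinite G)
    {x : Fin n → G} {rels : List (GWord (Fin n))} (hx : Presents x rels) (u : GWord ℕ)
    (W : ACWord ℕ) :
    ∃ c, letterCount (((n, rels.map (GWord.rename Fin.val)), u), W) = Part.some c ∧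
      (c.1 = c.2 ↔ Raag.expSum (Γ := commutationGraph G) (GWord.eval (extendByOne x) u)
        (acEval (extendByOne x) W) = 1) := by
  refine ⟨_, List.foldlM_eq_some (h' := fun c a =>
    if GWord.eval (extendByOne x) a.1 = GWord.eval (extendByOne x) u then countLetter c a.2
    else c) (fun c a _ => ?_) _, ?_⟩
  -- The letter `[w]` is compared with `[u]` by testing whether `w u⁻¹` represents `1`.
  · rw [isOneTest_eq hG hx, Part.map_some, GWord.eval_append, GWord.eval_invRev]
    simp only [decide_eq_true_eq, mul_inv_eq_one]
  · have h := ofAdd_letterCount (extendByOne x) (GWord.eval (extendByOne x) u) W (0, 0)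
    simp only [Nat.cast_zero, sub_self, ofAdd_zero, one_mul] at h
    rw [← h, ofAdd_eq_one, sub_eq_zero, Nat.cast_inj]

theorem List.foldl_or_eq {β : Type} (p : β → Bool) (l : List β) (b : Bool) :
    l.foldl (fun b a => b || p a) b = (b || l.any p) := by
  induction l generalizing b with
  | nil => simp
  | cons a l ih => rw [List.foldl_cons, ih, List.any_cons, Bool.or_assoc]

theorem List.foldl_and_eq {β : Type} (p : β → Bool) (l : List β) (b : Bool) :
    l.foldl (fun b a => b && p a) b = (b && l.all p) := by
  induction l generalizing b with
  | nil => simp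
  | cons a l ih => rw [List.foldl_cons, ih, List.all_cons, Bool.and_assoc]

theorem mem_groupLike_coact_iff {G : ACCoalgebra.{u}} {n : ℕ} {x : Fin n → G.A}
    {rels : List (GWord (Fin n))} (hx : Presents x rels) {W : Fin n → ACWord (Fin n)}
    (hW : ∀ i, G.a.hom (x i) = ACWord.eval x (W i)) (g : G.A) :
    g ∈ groupLike G.coact ↔
      ∃ V ∈ List.ofFn fun i => GWord.rename (GWord.rename Fin.val) (W i),
        Raag.expSum (Γ := commutationGraph G.A) g (acEval (extendByOne x) V) ≠ 1 := by
  rw [mem_groupLike_iff G.counit_coact G.coassoc_coact hx.1]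
  have : ∀ i, G.coact (x i) =
      acEval (extendByOne x) (GWord.rename (GWord.rename Fin.val) (W i)) := fun i => by
    rw [acEval_extendByOne_rename]; exact hW i
  constructor
  · rintro ⟨i, hi⟩
    exact ⟨_, (List.mem_ofFn' _ _).2 ⟨i, rfl⟩, by rwa [this] at hi⟩
  · rintro ⟨_, hV, hne⟩
    obtain ⟨i, rfl⟩ := (List.mem_ofFn' _ _).1 hV
    exact ⟨i, by rwa [this]⟩

open Classical in
theorem groupLikeTest_eq {G : ACCoalgebra.{u}} {n : ℕ} {x : Fin n → G.A}
    {rels : List (GWord (Fin n))} (hx : Presents x rels) {W : Fin n → ACWord (Fin n)}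
    (hW : ∀ i, G.a.hom (x i) = ACWord.eval x (W i)) (u : GWord ℕ) :
    groupLikeTest ((n, rels.map (GWord.rename Fin.val),
      List.ofFn fun i => GWord.rename (GWord.rename Fin.val) (W i)), u) =
      Part.some (decide (GWord.eval (extendByOne x) u ∈ groupLike G.coact)) := by
  choose c hc hc' using exists_letterCount_eq G.isResiduallyFinite hx u
  refine (List.foldlM_eq_some (h' := fun b V => b || !decide ((c V).1 = (c V).2))
    (fun b V _ => by rw [hc, Part.map_some]) _).trans (congrArg Part.some ?_)
  rw [List.foldl_or_eq, Bool.false_or, Bool.eq_iff_iff, List.any_eq_true, decide_eq_true_eq,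
    mem_groupLike_coact_iff hx hW]
  simp only [Bool.not_eq_true', decide_eq_false_iff_not, hc', ne_eq]

theorem GWord.eval_subst {G : Type u} [Group G] (y : ℕ → G) (L : List (GWord ℕ)) (w : GWord ℕ) :
    eval y (subst L w) = eval (fun i => eval y (L.getD i [])) w := by
  induction w with
  | nil => rfl
  | cons a w ih =>
    rw [eval_cons, ← ih, ← GWord.eval_invRev]
    refine (eval_append y _ (subst L w)).trans ?_
    congr 1
    split_ifs with h <;> simp [h]

theorem GWord.map_eval {α : Type} {G H : Type u} [Group G] [Group H] (f : G →* H) (x : α → G)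
    (w : GWord α) : f (eval x w) = eval (f ∘ x) w := by
  induction w with
  | nil => exact map_one f
  | cons a w ih =>
    rw [eval_cons, eval_cons, map_mul, ih]
    split_ifs <;> simp

theorem eval_subst_extendByOne {n m : ℕ} {G H : Type u} [Group G] [Group H] (f : G →* H)
    {x : Fin n → G} {y : Fin m → H} {M : Fin n → GWord (Fin m)}
    (hM : ∀ i, f (x i) = GWord.eval y (M i)) (w : GWord ℕ) :
    GWord.eval (extendByOne y) (GWord.subst (List.ofFn fun i => GWord.rename Fin.val (M i)) w) =
      f (GWord.eval (extendByOne x) w) := by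
  rw [GWord.eval_subst, GWord.map_eval]
  refine congrArg (fun z => GWord.eval z w) (funext fun i => ?_)
  by_cases hi : i < n
  · rw [List.getD_eq_getElem _ _ (by simpa using hi), List.getElem_ofFn, eval_extendByOne_rename,
      ← hM, Function.comp_apply, extendByOne, dif_pos hi]
  -- A letter without a meaning is replaced by the empty word, so both sides are `1`.
  · rw [List.getD_eq_default _ _ (by simpa using hi), Function.comp_apply,
      extendByOne_of_le x (not_lt.1 hi), map_one]
    exact map_one _

open Classical in
theorem raagMapTest_eq {G H : ACCoalgebra.{u}} {f : G.A ⟶ H.A} {d : InputData}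
    {x : Fin d.n → G.A} {y : Fin d.m → H.A} (hd : d.Describes f x y) :
    raagMapTest d.code =
      Part.some (decide (∀ g ∈ groupLike G.coact, f.hom g ∈ groupLike H.coact)) := by
  refine (List.foldlM_eq_some (h' := fun b a => b &&
    (!decide (GWord.eval (extendByOne x) a.1 ∈ groupLike G.coact) ||
      decide (f.hom (GWord.eval (extendByOne x) a.1) ∈ groupLike H.coact)))
    (fun b a _ => ?_) _).trans (congrArg Part.some ?_)
  · rw [InputData.code, groupLikeTest_eq hd.presG hd.coactG, Part.bind_some,
      groupLikeTest_eq hd.presH hd.coactH, Part.map_some,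
      eval_subst_extendByOne f.hom hd.map]
  · rw [List.foldl_and_eq, Bool.true_and, Bool.eq_iff_iff, List.all_eq_true, decide_eq_true_eq]
    simp only [Bool.or_eq_true, Bool.not_eq_true', decide_eq_false_iff_not, decide_eq_true_eq,
      ← imp_iff_not_or]
    constructor
    · intro h g hg
      -- An arbitrary group-like `g` is represented by one of the letters that the algorithm has
      -- tested.
      obtain ⟨V, hV, hne⟩ := (mem_groupLike_coact_iff hd.presG hd.coactG g).1 hg
      obtain ⟨a, ha, rfl⟩ := exists_letter_of_expSum_ne_one hne
      exact h a (List.mem_flatten.2 ⟨V, hV, ha⟩) hg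
    · exact fun h a _ => h _

/-- One partial recursive function, uniform in all the data, halts on every finite description of
a homomorphism between finitely presented groups with `AC`-coalgebra structures, and answers
whether the homomorphism is `A φ` for a graph homomorphism `φ` of the graphs presenting the two
coalgebras. Such graphs exist, and the answer is right for every choice of them. -/
theorem mainTheorem4 :
    ∃ alg : InputCode →. Bool, Partrec alg ∧
      ∀ (G H : ACCoalgebra.{u}) (f : G.A ⟶ H.A) (d : InputData)
        (x : Fin d.n → G.A) (y : Fin d.m → H.A), d.Describes f x y →
        Nonempty (GraphPresentation G) ∧ Nonempty (GraphPresentation H) ∧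
        ∃ b : Bool, b ∈ alg d.code ∧
          ∀ (p : GraphPresentation G) (q : GraphPresentation H), b = true ↔ IsRaagMap p q f := by
  classical
  refine ⟨raagMapTest, partrec_raagMapTest, fun G H f d x y hd =>
    ⟨G.nonempty_graphPresentation, H.nonempty_graphPresentation,
      decide (∀ g ∈ groupLike G.coact, f.hom g ∈ groupLike H.coact), ?_, fun p q => ?_⟩⟩
  · rw [raagMapTest_eq hd]; exact Part.mem_some _
  · rw [decide_eq_true_eq, isRaagMap_iff]
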